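/- Fix $d\ge 1$, integers $1\le i_1<\dots<i_d$ and $\theta\in(0,1)$. For $n\ge 2$ let $\mathcal G(n,p)$ be the Erdős–Rényi random graph on $n$ vertices, each of the $\binom n2$ edges being present independently with probability $p=\theta/(n-1)$. For $i\ge 0$ let $V_i$ be the number of vertices of degree $i$ in $\mathcal G(n,p)$, put $F_i:=(V_i-\mathbb E[V_i])/\sqrt n$ and $\mathbf F_{\mathbf D}:=(F_{i_1},\dots,F_{i_d})$. Let $\Sigma=(\Sigma_{ab})_{a,b=1}^d$ be the matrix with entries $$\Sigma_{ab}=\sigma(i_a,i_b),\qquad \sigma(i,j):=\frac{\theta^{i+j}}{i!\,j!}\,e^{-2\theta}\Big(\frac{(i-\theta)(j-\theta)}{\theta}-1\Big)+\mathbf 1\{i=j\}\,\frac{\theta^i}{i!}\,e^{-\theta}.$$ Then $\Sigma$ is symmetric and positive semidefinite. Moreover, let $\mathbf N_\Sigma$ be a $d$-dimensional centred Gaussian vector with covariance matrix $\Sigma$. Then there is a constant $c>0$ depending only on $i_1,\dots,i_d$ and $\theta$ such that, for all sufficiently large $n$, $$d_4(\mathbf F_{\mathbf D},\mathbf N_\Sigma)\le\frac{c}{\sqrt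 n}.$$ Here $d_4(\mathbf X,\mathbf Y):=\sup_g|\mathbb E[g(\mathbf X)]-\mathbb E[g(\mathbf Y)]|$ for $\mathbb R^d$-valued random vectors $\mathbf X,\mathbf Y$, where the supremum runs over all four times partially differentiable $g:\mathbb R^d\to\mathbb R$ such that, for $k=1,2,3,4$, all partial derivatives of order $k$ of $g$ are bounded by $1$ in absolute value. -/

import Mathlib

open MeasureTheory ProbabilityTheory Filter

noncomputable section

namespace DegreeCLT

/-- The partial derivative `∂g/∂x_i` of `g : ℝ^d → ℝ` (meaningful where it exists). -/
def partialDeriv {d : ℕ} (i : Fin d) (g : EuclideanSpace ℝ (Fin d) → ℝ) :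
    EuclideanSpace ℝ (Fin d) → ℝ :=
  fun x => lineDeriv ℝ g x (EuclideanSpace.single i 1)

/-- The iterated partial derivative `∂^k g / ∂x_{i_1} ⋯ ∂x_{i_k}` along the list
`[i_1, …, i_k]`; the last index is differentiated first. -/
def iterPartialDeriv {d : ℕ} :
    List (Fin d) → (EuclideanSpace ℝ (Fin d) → ℝ) → EuclideanSpace ℝ (Fin d) → ℝ
  | [], g => g
  | i :: l, g => partialDeriv i (iterPartialDeriv l g)

/-- `g` is `k` times partially differentiable: all iterated partial derivatives of `g` of
order less than `k` have a partial derivative in every coordinate direction at every point. -/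
def PartiallyDifferentiable {d : ℕ} (k : ℕ) (g : EuclideanSpace ℝ (Fin d) → ℝ) : Prop :=
  ∀ l : List (Fin d), l.length < k → ∀ (i : Fin d) (x : EuclideanSpace ℝ (Fin d)),
    LineDifferentiableAt ℝ (iterPartialDeriv l g) x (EuclideanSpace.single i 1)

/-- `M_k(g)`, the maximum over all `i_1, …, i_k` of the supremum norm of
`∂^k g / ∂x_{i_1} ⋯ ∂x_{i_k}`, with values in `[0, ∞]`. -/
def supPartialDeriv {d : ℕ} (k : ℕ) (g : EuclideanSpace ℝ (Fin d) → ℝ) : ENNReal :=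
  ⨆ (l : Fin k → Fin d) (x : EuclideanSpace ℝ (Fin d)),
    ENNReal.ofReal |iterPartialDeriv (List.ofFn l) g x|

/-- The test functions of the `d_4`-distance: four times partially differentiable functions
with `M_1(g), M_2(g), M_3(g), M_4(g) ≤ 1` (in particular, with bounded partial derivatives;
such functions are Lipschitz). -/
def D4TestFunction {d : ℕ} (g : EuclideanSpace ℝ (Fin d) → ℝ) : Prop :=
  PartiallyDifferentiable 4 g ∧
    ∀ k ∈ Finset.Icc 1 4, supPartialDeriv k g ≤ 1

/-- The `d_4`-distance between two laws on `ℝ^d`, with values in `[0, ∞]`. -/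
def d4 {d : ℕ} (μ ν : Measure (EuclideanSpace ℝ (Fin d))) : ENNReal :=
  ⨆ (g : EuclideanSpace ℝ (Fin d) → ℝ) (_ : D4TestFunction g),
    ENNReal.ofReal |∫ x, g x ∂μ - ∫ x, g x ∂ν|

open Classical in
/-- `V_i(G)`, the number of vertices of degree `i` in a graph `G` on `n` vertices. -/
def degreeCount {n : ℕ} (i : ℕ) (G : SimpleGraph (Fin n)) : ℕ :=
  (Finset.univ.filter fun v : Fin n => G.degree v = i).card

/-- `F_i = (V_i - 𝔼[V_i]) / √n` for the Erdős–Rényi random graph `G(n, p)`. -/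
def normDegreeCount (n : ℕ) (p : unitInterval) (i : ℕ) (G : SimpleGraph (Fin n)) : ℝ :=
  ((degreeCount i G : ℝ) -
    ∫ H, (degreeCount i H : ℝ) ∂(SimpleGraph.binomialRandom (Fin n) p)) / √(n : ℝ)

/-- The law of the random vector `(F_{i_1}, …, F_{i_d})`. -/
def degreeVectorLaw {d : ℕ} (n : ℕ) (p : unitInterval) (i : Fin d → ℕ) :
    Measure (EuclideanSpace ℝ (Fin d)) :=
  (SimpleGraph.binomialRandom (Fin n) p).map
    fun G => WithLp.toLp 2 fun a => normDegreeCount n p (i a) G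

/-- The limiting covariance of `F_i` and `F_j`. -/
def limitCov (θ : ℝ) (i j : ℕ) : ℝ :=
  θ ^ (i + j) / ((i.factorial : ℝ) * (j.factorial : ℝ)) * Real.exp (-2 * θ) *
      (((i : ℝ) - θ) * ((j : ℝ) - θ) / θ - 1) +
    if i = j then θ ^ i / (i.factorial : ℝ) * Real.exp (-θ) else 0

/-- The matrix `Σ` with entries `limitCov θ i_a i_b`. -/
def limitCovMatrix {d : ℕ} (θ : ℝ) (i : Fin d → ℕ) : Matrix (Fin d) (Fin d) ℝ :=
  Matrix.of fun a b => limitCov θ (i a) (i b)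

end DegreeCLT

end

/-!
The covariance matrix is positive semidefinite because, with Poisson weights `q_a` at `i_a`, its
quadratic form is `∑ q_a x_a² - (∑ q_a x_a)² + (∑ q_a (i_a - θ) x_a)² / θ`, and Cauchy–Schwarz
applies since `∑ q_a ≤ 1` (`posSemidef_limitCovMatrix`).

The rate of convergence comes from Stein's method by removal of a vertex. A centred Gaussian vector
`N` with covariance `S` satisfies `𝔼[N_i h(N)] = ∑_j S_ij 𝔼[∂_j h(N)]`. A law satisfying this
identity up to `ε`, for all `h` whose partial derivatives are bounded by `1` and `1`-Lipschitz, is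
at `d_4`-distance at most `(π / 2) d ε` from `N`: along the rotation `cos s • F + sin s • N`, with
`F` and `N` independent, the derivative of `𝔼[g(cos s • F + sin s • N)]` is a difference of two
terms which agree up to `ε` by the two identities, applied with `h = ∂_i g`
(`abs_integral_sub_integral_multivariateGaussian_le`). Three orders of bounded partial derivatives
suffice for this.

For the random graph write `F_i = n^{-1/2} ∑_v ξ_v`, where `ξ_v` is the centred indicator that `v`
has degree `i`. The neighbours of `v` are independent of the graph `G^v` obtained by deleting all
edges at `v` (`integral_star_mul`), so `𝔼[ξ_v h(F(G))] = 𝔼[ξ_v (h(F(G)) - h(F(G^v)))]`. A Taylor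
expansion at `F(G^v)` has main term `n^{-1/2} ∑_j 𝔼[ξ_v D_j ∂_j h(F(G^v))]`, where `D_j` is the
change of the number of vertices of degree `j`. Averaging over the neighbours of `v` given `G^v`
replaces `ξ_v D_j` by the conditional covariance `attachCov`, which is affine in the numbers of
vertices of degrees `j - 1` and `j` in `G^v`. These counts have variance of order `n`, by the same
removal argument, and the binomial degree weights are within `O(1 / n)` of the Poisson weights, so
`attachCov` is within `O(n^{-1/2})` of the limiting covariance in `L¹`
(`integral_abs_attachCov_sub_limitCov_le`). The remaining errors are controlled by the second
moment of a degree.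
-/

namespace DegreeCLT

/-! ### Test functions with bounded partial derivatives -/

section Calculus

variable {d : ℕ}

/-- The `ℓ¹`-norm on `ℝ^d`, the natural norm for bounds on partial derivatives. -/
def l1 (x : EuclideanSpace ℝ (Fin d)) : ℝ := ∑ k, |x k|

lemma l1_nonneg (x : EuclideanSpace ℝ (Fin d)) : 0 ≤ l1 x :=
  Finset.sum_nonneg fun _ _ => abs_nonneg _

lemma l1_le_norm (x : EuclideanSpace ℝ (Fin d)) : l1 x ≤ d * ‖x‖ := by
  calc l1 x ≤ ∑ _k : Fin d, ‖x‖ := Finset.sum_le_sum fun k _ => by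
        simpa using PiLp.norm_apply_le x k
    _ = d * ‖x‖ := by simp

lemma l1_smul (c : ℝ) (x : EuclideanSpace ℝ (Fin d)) : l1 (c • x) = |c| * l1 x := by
  simp [l1, abs_mul, Finset.mul_sum]

/-- `h'` is the family of partial derivatives of `h`, bounded by `1` and `1`-Lipschitz for the
`ℓ¹`-norm. The derivative relation is recorded as a quadratic Taylor bound. -/
structure HasBoundedPartials (h : EuclideanSpace ℝ (Fin d) → ℝ)
    (h' : Fin d → EuclideanSpace ℝ (Fin d) → ℝ) : Prop where
  bound : ∀ j x, |h' j x| ≤ 1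
  lipschitz : ∀ j x y, |h' j y - h' j x| ≤ l1 (y - x)
  taylor : ∀ x y, |h y - h x - ∑ j, h' j x * (y j - x j)| ≤ l1 (y - x) ^ 2

/-- Mean value inequality along a coordinate line. -/
lemma abs_sub_sub_mul_le_of_hasLineDerivAt {u u' : EuclideanSpace ℝ (Fin d) → ℝ}
    {e x : EuclideanSpace ℝ (Fin d)} {c M τ : ℝ} (hu : ∀ x, HasLineDerivAt ℝ u (u' x) x e)
    (hM : ∀ t : ℝ, |t| ≤ |τ| → |u' (x + t • e) - c| ≤ M) :
    |u (x + τ • e) - u x - c * τ| ≤ M * |τ| := by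
  have hd : ∀ t : ℝ, HasDerivAt (fun t : ℝ => u (x + t • e) - c * t) (u' (x + t • e) - c) t := by
    intro t
    have h1 : HasDerivAt (fun s : ℝ => u (x + t • e + s • e)) (u' (x + t • e)) (t - t) := by
      simpa [HasLineDerivAt] using hu (x + t • e)
    have h2 : HasDerivAt (fun s : ℝ => u (x + t • e + (s - t) • e)) (u' (x + t • e)) t := by
      have := h1.comp_sub_const t t
      simpa using this
    have h3 : (fun s : ℝ => u (x + t • e + (s - t) • e)) = fun s : ℝ => u (x + s • e) := by
      funext s; congr 1; module
    rw [h3] at h2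
    exact h2.sub (by simpa using (hasDerivAt_id t).const_mul c)
  have hconv : Convex ℝ (Set.Icc (-|τ|) |τ|) := convex_Icc _ _
  have := hconv.norm_image_sub_le_of_norm_hasDerivWithin_le (x := 0) (y := τ) (C := M)
    (f := fun t : ℝ => u (x + t • e) - c * t)
    (fun t _ => (hd t).hasDerivWithinAt)
    (fun t ht => hM t (abs_le.2 ht)) ⟨by simp, by simp⟩ ⟨neg_abs_le _, le_abs_self _⟩
  simp only [zero_smul, add_zero, mul_zero, sub_zero, Real.norm_eq_abs] at this
  convert this using 2
  ring

/-- Resetting the coordinate `a` of `y` to the value `t`. -/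
lemma eq_add_single_smul (y : EuclideanSpace ℝ (Fin d)) (a : Fin d) (t : ℝ) :
    ∃ z : EuclideanSpace ℝ (Fin d), z a = t ∧ (∀ k, k ≠ a → z k = y k) ∧
      y = z + (y a - t) • EuclideanSpace.single a (1 : ℝ) := by
  refine ⟨y + (t - y a) • EuclideanSpace.single a (1 : ℝ), by simp, fun k hk => by simp [hk], ?_⟩
  module

/-- Partial derivatives bounded by `1` make a function `1`-Lipschitz for the `ℓ¹`-norm: the
coordinates are changed one at a time. -/
lemma abs_sub_le_l1_of_hasLineDerivAt {u : EuclideanSpace ℝ (Fin d) → ℝ}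
    {u' : Fin d → EuclideanSpace ℝ (Fin d) → ℝ}
    (hu : ∀ j x, HasLineDerivAt ℝ u (u' j x) x (EuclideanSpace.single j 1))
    (hb : ∀ j x, |u' j x| ≤ 1) (x y : EuclideanSpace ℝ (Fin d)) :
    |u y - u x| ≤ l1 (y - x) := by
  suffices H : ∀ (s : Finset (Fin d)) (y : EuclideanSpace ℝ (Fin d)), (∀ k ∉ s, y k = x k) →
      |u y - u x| ≤ ∑ k ∈ s, |y k - x k| by
    simpa [l1] using H Finset.univ y (by simp)
  intro s
  induction s using Finset.induction_on with
  | empty =>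
    intro y hy
    have : y = x := by ext k; exact hy k (by simp)
    simp [this]
  | insert a s ha ih =>
    intro y hy
    obtain ⟨z, hza, hz, hyz⟩ := eq_add_single_smul y a (x a)
    have h1 : |u z - u x| ≤ ∑ k ∈ s, |y k - x k| := by
      refine (ih z fun k hk => ?_).trans (le_of_eq (Finset.sum_congr rfl fun k hk => ?_))
      · by_cases hka : k = a
        · rw [hka, hza]
        · rw [hz k hka, hy k (by simp [hka, hk])]
      · rw [hz k (by rintro rfl; exact ha hk)]
    have h2 : |u y - u z| ≤ |y a - x a| := by
      have := abs_sub_sub_mul_le_of_hasLineDerivAt (x := z) (c := 0) (M := 1) (τ := y a - x a)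
        (hu a) (fun t _ => by simpa using hb a _)
      rw [← hyz] at this
      simpa using this
    rw [Finset.sum_insert ha]
    calc |u y - u x| = |(u y - u z) + (u z - u x)| := by ring_nf
      _ ≤ _ := (abs_add_le _ _).trans (add_le_add h2 h1)

/-- Partial derivatives that are `1`-Lipschitz for the `ℓ¹`-norm give a quadratic Taylor remainder;
no total differentiability is assumed. -/
lemma abs_taylor_le_of_hasLineDerivAt {u : EuclideanSpace ℝ (Fin d) → ℝ}
    {u' : Fin d → EuclideanSpace ℝ (Fin d) → ℝ}
    (hu : ∀ j x, HasLineDerivAt ℝ u (u' j x) x (EuclideanSpace.single j 1))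
    (hl : ∀ j x y, |u' j y - u' j x| ≤ l1 (y - x)) (x y : EuclideanSpace ℝ (Fin d)) :
    |u y - u x - ∑ j, u' j x * (y j - x j)| ≤ l1 (y - x) ^ 2 := by
  suffices H : ∀ (s : Finset (Fin d)) (y : EuclideanSpace ℝ (Fin d)), (∀ k ∉ s, y k = x k) →
      |u y - u x - ∑ j ∈ s, u' j x * (y j - x j)| ≤ (∑ k ∈ s, |y k - x k|) ^ 2 by
    simpa [l1] using H Finset.univ y (by simp)
  intro s
  induction s using Finset.induction_on with
  | empty =>
    intro y hy
    have : y = x := by ext k; exact hy k (by simp)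
    simp [this]
  | insert a s ha ih =>
    intro y hy
    obtain ⟨z, hza, hz, hyz⟩ := eq_add_single_smul y a (x a)
    set T := ∑ k ∈ s, |y k - x k| with hT
    have hT0 : 0 ≤ T := Finset.sum_nonneg fun _ _ => abs_nonneg _
    have hzs : ∀ k ∈ s, z k = y k := fun k hk => hz k (by rintro rfl; exact ha hk)
    have hzx : ∀ k ∉ s, z k = x k := fun k hk => by
      by_cases hka : k = a
      · rw [hka, hza]
      · rw [hz k hka, hy k (by simp [hka, hk])]
    have h1 : |u z - u x - ∑ j ∈ s, u' j x * (y j - x j)| ≤ T ^ 2 := by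
      have := ih z hzx
      rwa [Finset.sum_congr rfl fun k hk => by rw [hzs k hk],
        show ∑ k ∈ s, |z k - x k| = T from Finset.sum_congr rfl fun k hk => by rw [hzs k hk]]
        at this
    have h2 : |u y - u z - u' a x * (y a - x a)| ≤ (|y a - x a| + T) * |y a - x a| := by
      have := abs_sub_sub_mul_le_of_hasLineDerivAt (x := z) (c := u' a x)
        (M := |y a - x a| + T) (τ := y a - x a) (hu a) (fun t ht => by
          refine (hl a _ _).trans ?_
          have : l1 (z + t • EuclideanSpace.single a (1 : ℝ) - x) =
              ∑ k ∈ insert a s, |z k + t * (if k = a then 1 else 0) - x k| := by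
            symm
            rw [l1]
            refine (Finset.sum_subset (Finset.subset_univ _) fun k _ hk => ?_).trans ?_
            · simp only [Finset.mem_insert, not_or] at hk
              simp [hk.1, hzx k hk.2]
            · refine Finset.sum_congr rfl fun k _ => ?_
              simp
          rw [this, Finset.sum_insert ha]
          refine add_le_add (by simpa [hza] using ht) (le_of_eq ?_)
          refine Finset.sum_congr rfl fun k hk => ?_
          have : k ≠ a := by rintro rfl; exact ha hk
          simp [this, hzs k hk])
      rwa [← hyz] at this
    rw [Finset.sum_insert ha, Finset.sum_insert ha]
    calc |u y - u x - (u' a x * (y a - x a) + ∑ j ∈ s, u' j x * (y j - x j))|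
        = |(u y - u z - u' a x * (y a - x a)) +
            (u z - u x - ∑ j ∈ s, u' j x * (y j - x j))| := by ring_nf
      _ ≤ (|y a - x a| + T) * |y a - x a| + T ^ 2 := (abs_add_le _ _).trans (add_le_add h2 h1)
      _ ≤ (|y a - x a| + T) ^ 2 := by nlinarith [abs_nonneg (y a - x a)]

namespace HasBoundedPartials

variable {h : EuclideanSpace ℝ (Fin d) → ℝ} {h' : Fin d → EuclideanSpace ℝ (Fin d) → ℝ}

/-- The total derivative of a function with bounded Lipschitz partial derivatives. -/
lemma hasFDerivAt (hh : HasBoundedPartials h h') (x : EuclideanSpace ℝ (Fin d)) :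
    HasFDerivAt h (∑ j, h' j x • (EuclideanSpace.proj j : EuclideanSpace ℝ (Fin d) →L[ℝ] ℝ)) x := by
  rw [hasFDerivAt_iff_isLittleO_nhds_zero]
  have hO : (fun z : EuclideanSpace ℝ (Fin d) => h (x + z) - h x -
      (∑ j, h' j x • (EuclideanSpace.proj j : EuclideanSpace ℝ (Fin d) →L[ℝ] ℝ)) z)
      =O[nhds 0] fun z => ‖z‖ ^ 2 := by
    refine Asymptotics.IsBigO.of_bound ((d : ℝ) ^ 2) (Eventually.of_forall fun z => ?_)
    have h1 := hh.taylor x (x + z)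
    simp only [PiLp.add_apply, add_sub_cancel_left] at h1
    simp only [sum_apply, smul_apply, smul_eq_mul, PiLp.proj_apply, Real.norm_eq_abs]
    refine h1.trans ?_
    rw [abs_of_nonneg (by positivity), ← mul_pow]
    exact pow_le_pow_left₀ (l1_nonneg _) (l1_le_norm _) 2
  refine hO.trans_isLittleO ?_
  simpa using Asymptotics.isLittleO_norm_pow_id (E' := EuclideanSpace ℝ (Fin d)) one_lt_two

lemma continuous (hh : HasBoundedPartials h h') : Continuous h :=
  continuous_iff_continuousAt.2 fun x => (hh.hasFDerivAt x).continuousAt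

lemma continuous_partial (hh : HasBoundedPartials h h') (j : Fin d) : Continuous (h' j) := by
  have : LipschitzWith (d : NNReal) (h' j) := LipschitzWith.of_dist_le_mul fun x y => by
    rw [Real.dist_eq, dist_eq_norm]
    exact (hh.lipschitz j y x).trans (by simpa using l1_le_norm (x - y))
  exact this.continuous

lemma hasDerivAt_comp (hh : HasBoundedPartials h h') {γ : ℝ → EuclideanSpace ℝ (Fin d)}
    {γ' : EuclideanSpace ℝ (Fin d)} {t : ℝ} (hγ : HasDerivAt γ γ' t) :
    HasDerivAt (fun s => h (γ s)) (∑ j, h' j (γ t) * γ' j) t := by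
  have := (hh.hasFDerivAt (γ t)).comp_hasDerivAt t hγ
  simpa [Function.comp_def] using this

lemma abs_sub_le (hh : HasBoundedPartials h h') (x y : EuclideanSpace ℝ (Fin d)) :
    |h y - h x| ≤ l1 (y - x) := by
  refine abs_sub_le_l1_of_hasLineDerivAt (u' := h') (fun j x => ?_) hh.bound x y
  have := (hh.hasFDerivAt x).hasLineDerivAt (EuclideanSpace.single j (1 : ℝ))
  simpa [Finset.sum_ite_eq] using this

lemma abs_le (hh : HasBoundedPartials h h') (x : EuclideanSpace ℝ (Fin d)) :
    |h x| ≤ |h 0| + d * ‖x‖ := by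
  have h1 := (hh.abs_sub_le 0 x).trans (l1_le_norm _)
  have h2 := abs_sub_abs_le_abs_sub (h x) (h 0)
  simp only [sub_zero] at h1
  linarith

/-- The class is stable under contractions and translations of the argument. -/
lemma comp_smul_add (hh : HasBoundedPartials h h') {c : ℝ} (hc : |c| ≤ 1)
    (y : EuclideanSpace ℝ (Fin d)) :
    HasBoundedPartials (fun x => h (c • x + y)) (fun j x => c * h' j (c • x + y)) where
  bound j x := by
    rw [abs_mul]
    exact mul_le_one₀ hc (abs_nonneg _) (hh.bound j _)
  lipschitz j x z := by
    have h1 := hh.lipschitz j (c • x + y) (c • z + y)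
    rw [show c • z + y - (c • x + y) = c • (z - x) by module, l1_smul] at h1
    rw [← mul_sub, abs_mul]
    have h2 : |c| * l1 (z - x) ≤ l1 (z - x) := mul_le_of_le_one_left (l1_nonneg _) hc
    calc _ ≤ 1 * |h' j (c • z + y) - h' j (c • x + y)| := by gcongr
      _ ≤ _ := by linarith
  taylor x z := by
    have h1 := hh.taylor (c • x + y) (c • z + y)
    rw [show c • z + y - (c • x + y) = c • (z - x) by module, l1_smul] at h1
    have h2 : |c| * l1 (z - x) ≤ l1 (z - x) := mul_le_of_le_one_left (l1_nonneg _) hc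
    have h3 : (|c| * l1 (z - x)) ^ 2 ≤ l1 (z - x) ^ 2 :=
      pow_le_pow_left₀ (mul_nonneg (abs_nonneg _) (l1_nonneg _)) h2 2
    refine le_trans (le_of_eq ?_) (h1.trans h3)
    congr 2
    refine Finset.sum_congr rfl fun j _ => ?_
    simp only [PiLp.add_apply, PiLp.smul_apply, smul_eq_mul]
    ring

end HasBoundedPartials

lemma abs_iterPartialDeriv_le_one {g : EuclideanSpace ℝ (Fin d) → ℝ} (hg : D4TestFunction g)
    (l : List (Fin d)) (h1 : 1 ≤ l.length) (h4 : l.length ≤ 4) (x : EuclideanSpace ℝ (Fin d)) :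
    |iterPartialDeriv l g x| ≤ 1 := by
  have h := hg.2 l.length (Finset.mem_Icc.2 ⟨h1, h4⟩)
  have h2 : ENNReal.ofReal |iterPartialDeriv (List.ofFn l.get) g x| ≤ 1 :=
    (le_iSup₂ (f := fun (l : Fin l.length → Fin d) (x : EuclideanSpace ℝ (Fin d)) =>
      ENNReal.ofReal |iterPartialDeriv (List.ofFn l) g x|) l.get x).trans h
  rw [List.ofFn_get] at h2
  simpa using h2

/-- A test function of the `d_4`-distance and its partial derivatives of order at most two belong
to the class `HasBoundedPartials`. -/
lemma D4TestFunction.hasBoundedPartials {g : EuclideanSpace ℝ (Fin d) → ℝ} (hg : D4TestFunction g)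
    (l : List (Fin d)) (hl : l.length ≤ 2) :
    HasBoundedPartials (iterPartialDeriv l g) (fun j => iterPartialDeriv (j :: l) g) := by
  have hd : ∀ l : List (Fin d), l.length < 4 → ∀ j x,
      HasLineDerivAt ℝ (iterPartialDeriv l g) (iterPartialDeriv (j :: l) g x) x
        (EuclideanSpace.single j 1) := fun l hl j x => (hg.1 l hl j x).hasLineDerivAt
  have hlip : ∀ j x y, |iterPartialDeriv (j :: l) g y - iterPartialDeriv (j :: l) g x| ≤
      l1 (y - x) := fun j x y =>
    abs_sub_le_l1_of_hasLineDerivAt (hd (j :: l) (by simp; omega))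
      (fun k z => abs_iterPartialDeriv_le_one hg _ (by simp) (by simp; omega) z) x y
  exact ⟨fun j x => abs_iterPartialDeriv_le_one hg _ (by simp) (by simp; omega) x, hlip,
    abs_taylor_le_of_hasLineDerivAt (hd l (by omega)) hlip⟩

end Calculus

/-! ### Gaussian integration by parts -/

section Gaussian

lemma integrable_gaussianReal_iff {f : ℝ → ℝ} :
    Integrable f (gaussianReal 0 1) ↔ Integrable (fun x => gaussianPDFReal 0 1 x * f x) := by
  rw [gaussianReal_of_var_ne_zero _ one_ne_zero, integrable_withDensity_iff_integrable_smul'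
    (measurable_gaussianPDF 0 1) (Eventually.of_forall fun _ => gaussianPDF_lt_top)]
  simp [toReal_gaussianPDF]

lemma hasDerivAt_gaussianPDFReal (x : ℝ) :
    HasDerivAt (gaussianPDFReal 0 1) (-(x * gaussianPDFReal 0 1 x)) x := by
  have h : HasDerivAt (fun x : ℝ => -(x - 0) ^ 2 / (2 * (1 : NNReal))) (-x) x := by
    have := (((hasDerivAt_id x).sub_const 0).pow 2).neg.div_const (2 * ((1 : NNReal) : ℝ))
    refine this.congr_deriv ?_
    simp
    ring
  have := h.exp.const_mul (√(2 * Real.pi * (1 : NNReal)))⁻¹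
  rw [gaussianPDFReal_def]
  refine this.congr_deriv ?_
  ring

/-- Stein's lemma for the standard normal distribution on the line. -/
lemma integral_mul_gaussianReal {f f' : ℝ → ℝ} (hf : ∀ x, HasDerivAt f (f' x) x)
    (h1 : Integrable f (gaussianReal 0 1)) (h2 : Integrable f' (gaussianReal 0 1))
    (h3 : Integrable (fun x => x * f x) (gaussianReal 0 1)) :
    ∫ x, x * f x ∂(gaussianReal 0 1) = ∫ x, f' x ∂(gaussianReal 0 1) := by
  rw [integral_gaussianReal_eq_integral_smul one_ne_zero,
    integral_gaussianReal_eq_integral_smul one_ne_zero]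
  rw [integrable_gaussianReal_iff] at h1 h2 h3
  have := integral_mul_deriv_eq_deriv_mul_of_integrable (u := gaussianPDFReal 0 1)
    (u' := fun x => -(x * gaussianPDFReal 0 1 x)) (v := f) (v' := f')
    (fun x _ => hasDerivAt_gaussianPDFReal x) (fun x _ => hf x) h2
    (h3.neg.congr (Eventually.of_forall fun x => by simp; ring)) h1
  simp only [smul_eq_mul]
  rw [this, ← integral_neg]
  congr 1
  funext x
  ring

/-- Stein's lemma in one coordinate of a product of standard normal distributions. -/
lemma integral_coord_mul_pi_gaussianReal {d : ℕ} (k : Fin d) {f f' : (Fin d → ℝ) → ℝ}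
    (hf : ∀ z t, HasDerivAt (fun s => f (Function.update z k s)) (f' (Function.update z k t)) t)
    (h1 : Integrable f (Measure.pi fun _ : Fin d => gaussianReal 0 1))
    (h2 : Integrable f' (Measure.pi fun _ : Fin d => gaussianReal 0 1))
    (h3 : Integrable (fun z => z k * f z) (Measure.pi fun _ : Fin d => gaussianReal 0 1)) :
    ∫ z, z k * f z ∂(Measure.pi fun _ : Fin d => gaussianReal 0 1) =
      ∫ z, f' z ∂(Measure.pi fun _ : Fin d => gaussianReal 0 1) := by
  obtain _ | d := d
  · exact k.elim0
  have hmp := (measurePreserving_piFinSuccAbove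
    (fun _ : Fin (d + 1) => gaussianReal 0 1) k).symm
  have e : ∀ p : ℝ × (Fin d → ℝ),
      (MeasurableEquiv.piFinSuccAbove (fun _ : Fin (d + 1) => ℝ) k).symm p = k.insertNth p.1 p.2 :=
    fun p => rfl
  rw [← hmp.integrable_comp_emb (MeasurableEquiv.measurableEmbedding _)] at h1 h2 h3
  rw [← hmp.integral_comp', ← hmp.integral_comp']
  simp only [Function.comp_def, e] at h1 h2 h3 ⊢
  rw [integral_prod_symm _ h3, integral_prod_symm _ h2]
  refine integral_congr_ae ?_
  filter_upwards [h1.prod_left_ae, h2.prod_left_ae, h3.prod_left_ae] with y k1 k2 k3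
  simp only [Fin.insertNth_apply_same] at k1 k2 k3 ⊢
  refine integral_mul_gaussianReal (fun t => ?_) k1 k2 k3
  have := hf (k.insertNth 0 y) t
  simpa only [Fin.update_insertNth] using this

variable {d : ℕ} {h : EuclideanSpace ℝ (Fin d) → ℝ} {h' : Fin d → EuclideanSpace ℝ (Fin d) → ℝ}

lemma HasBoundedPartials.integrable_of_isGaussian (hh : HasBoundedPartials h h')
    (μ : Measure (EuclideanSpace ℝ (Fin d))) [IsGaussian μ] : Integrable h μ := by
  refine Integrable.mono' (g := fun x => |h 0| + d * ‖x‖) ?_ hh.continuous.aestronglyMeasurable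
    (Eventually.of_forall hh.abs_le)
  exact (integrable_const _).add (IsGaussian.integrable_id.norm.const_mul _)

lemma HasBoundedPartials.integrable_partial (hh : HasBoundedPartials h h') (j : Fin d)
    (μ : Measure (EuclideanSpace ℝ (Fin d))) [IsFiniteMeasure μ] : Integrable (h' j) μ :=
  Integrable.mono' (integrable_const 1) (hh.continuous_partial j).aestronglyMeasurable
    (Eventually.of_forall (hh.bound j))

open scoped MatrixOrder in
/-- Stein's lemma for a centred Gaussian vector `N` with covariance matrix `S`:
`𝔼[N_i h(N)] = ∑_j S_ij 𝔼[∂_j h(N)]`. -/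
lemma HasBoundedPartials.integral_coord_mul_multivariateGaussian (hh : HasBoundedPartials h h')
    {S : Matrix (Fin d) (Fin d) ℝ} (hS : S.PosSemidef) (i : Fin d) :
    ∫ x, x i * h x ∂(multivariateGaussian 0 S) =
      ∑ j, S i j * ∫ x, h' j x ∂(multivariateGaussian 0 S) := by
  set A : Matrix (Fin d) (Fin d) ℝ := CFC.sqrt S
  have hAA : ∀ i j, ∑ k, A i k * A j k = S i j := by
    intro i j
    have h1 : A * A = S := CFC.sqrt_mul_sqrt_self S hS.nonneg
    have h2 : A.IsHermitian := (CFC.sqrt_nonneg S).isSelfAdjoint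
    calc ∑ k, A i k * A j k = ∑ k, A i k * A k j := Finset.sum_congr rfl fun k _ => by
          rw [← h2.apply j k]; simp
      _ = (A * A) i j := by rw [Matrix.mul_apply]
      _ = S i j := by rw [h1]
  -- the law is the image of a product of standard normal distributions under `z ↦ A z`
  let T : (Fin d → ℝ) → EuclideanSpace ℝ (Fin d) := fun z => WithLp.toLp 2 (A.mulVec z)
  have hT : ∀ z k, T z k = ∑ l, A k l * z l := fun z k => rfl
  have hlaw : multivariateGaussian 0 S = (Measure.pi fun _ : Fin d => gaussianReal 0 1).map T := by
    rw [multivariateGaussian, ← map_pi_eq_stdGaussian, Measure.map_map (by fun_prop) (by fun_prop)]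
    congr 1
    funext z
    simp only [Function.comp_apply, zero_add]
    exact Matrix.toEuclideanCLM_toLp _ _
  have hTc : Continuous T := by fun_prop
  have hTm : AEMeasurable T (Measure.pi fun _ : Fin d => gaussianReal 0 1) := hTc.aemeasurable
  have hc := hh.continuous
  have I1 : Integrable (fun z => h (T z)) (Measure.pi fun _ : Fin d => gaussianReal 0 1) := by
    have := hh.integrable_of_isGaussian (multivariateGaussian 0 S)
    rw [hlaw] at this
    exact (integrable_map_measure hc.aestronglyMeasurable hTm).1 this
  have I2 : ∀ j, Integrable (fun z => h' j (T z))
      (Measure.pi fun _ : Fin d => gaussianReal 0 1) := by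
    intro j
    have := hh.integrable_partial j (multivariateGaussian 0 S)
    rw [hlaw] at this
    exact (integrable_map_measure (hh.continuous_partial j).aestronglyMeasurable hTm).1 this
  have I3 : ∀ k, Integrable (fun z => z k * h (T z))
      (Measure.pi fun _ : Fin d => gaussianReal 0 1) := by
    intro k
    have hsq : Integrable (fun x : EuclideanSpace ℝ (Fin d) => ‖x‖ ^ 2)
        (stdGaussian (EuclideanSpace ℝ (Fin d))) :=
      (IsGaussian.memLp_two_id).integrable_norm_pow two_ne_zero
    set B := Matrix.toEuclideanCLM (𝕜 := ℝ) A
    have : Integrable (fun x : EuclideanSpace ℝ (Fin d) => x k * h (B x))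
        (stdGaussian (EuclideanSpace ℝ (Fin d))) := by
      refine Integrable.mono' (g := fun x => |h 0| * ‖x‖ + d * ‖B‖ * ‖x‖ ^ 2)
        ((IsGaussian.integrable_id.norm.const_mul _).add (hsq.const_mul _))
        (Continuous.aestronglyMeasurable (by fun_prop)) (Eventually.of_forall fun x => ?_)
      rw [norm_mul]
      have h1 : ‖x k‖ ≤ ‖x‖ := PiLp.norm_apply_le x k
      have h2 : ‖h (B x)‖ ≤ |h 0| + d * (‖B‖ * ‖x‖) :=
        (hh.abs_le (B x)).trans (by gcongr; exact B.le_opNorm x)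
      calc ‖x k‖ * ‖h (B x)‖ ≤ ‖x‖ * (|h 0| + d * (‖B‖ * ‖x‖)) := by gcongr
        _ = _ := by ring
    rw [← map_pi_eq_stdGaussian] at this
    exact (integrable_map_measure (Continuous.aestronglyMeasurable (by fun_prop))
      (by fun_prop)).1 this
  have hk : ∀ k, ∫ z, z k * h (T z) ∂(Measure.pi fun _ : Fin d => gaussianReal 0 1) =
      ∑ j, A j k * ∫ z, h' j (T z) ∂(Measure.pi fun _ : Fin d => gaussianReal 0 1) := by
    intro k
    rw [integral_coord_mul_pi_gaussianReal k (f := fun z => h (T z))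
      (f' := fun z => ∑ j, h' j (T z) * A j k) (fun z t => ?_) I1
      (integrable_finsetSum _ fun j _ => (I2 j).mul_const _) (I3 k),
      integral_finsetSum _ fun j _ => (I2 j).mul_const _]
    · exact Finset.sum_congr rfl fun j _ => by rw [integral_mul_const, mul_comm]
    · have hγ : HasDerivAt (fun s => T (Function.update z k s))
          (WithLp.toLp 2 fun j => A j k) t := by
        have hline : (fun s => T (Function.update z k s)) = fun s =>
            T (Function.update z k 0) + s • WithLp.toLp 2 fun j => A j k := by
          funext s
          have : Function.update z k s = Function.update z k 0 + s • Pi.single k (1 : ℝ) := by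
            funext l
            by_cases hl : l = k
            · subst hl; simp
            · simp [hl]
          simp only [T, this, Matrix.mulVec_add, Matrix.mulVec_smul, Matrix.mulVec_single_one,
            WithLp.toLp_add, WithLp.toLp_smul]
          rfl
        rw [hline]
        simpa using ((hasDerivAt_id t).smul_const (WithLp.toLp 2 fun j => A j k)).const_add
          (T (Function.update z k 0))
      exact hh.hasDerivAt_comp hγ
  rw [hlaw, integral_map hTm (Continuous.aestronglyMeasurable (by fun_prop))]
  simp only [integral_map hTm (hh.continuous_partial _).aestronglyMeasurable, hT]
  calc ∫ z, (∑ l, A i l * z l) * h (T z) ∂(Measure.pi fun _ : Fin d => gaussianReal 0 1)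
      = ∑ l, A i l * ∫ z, z l * h (T z) ∂(Measure.pi fun _ : Fin d => gaussianReal 0 1) := by
        simp only [Finset.sum_mul, mul_assoc]
        rw [integral_finsetSum _ fun l _ => (I3 l).const_mul _]
        simp only [integral_const_mul]
    _ = _ := by
        simp only [hk, Finset.mul_sum]
        rw [Finset.sum_comm]
        refine Finset.sum_congr rfl fun j _ => ?_
        rw [← hAA i j, Finset.sum_mul]
        exact Finset.sum_congr rfl fun l _ => by ring

end Gaussian

/-! ### From an approximate Stein identity to the `d_4`-distance -/

section Interpolation

variable {d : ℕ} {S : Matrix (Fin d) (Fin d) ℝ} {μ : Measure (EuclideanSpace ℝ (Fin d))}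

/-- The derivative of the rotation `s ↦ cos s • x + sin s • y`. -/
lemma hasDerivAt_rotation (x y : EuclideanSpace ℝ (Fin d)) (s : ℝ) :
    HasDerivAt (fun s => Real.cos s • x + Real.sin s • y)
      (-Real.sin s • x + Real.cos s • y) s :=
  ((Real.hasDerivAt_cos s).smul_const x).add ((Real.hasDerivAt_sin s).smul_const y)

/-- If a law `μ` satisfies the Gaussian integration by parts formula up to an error `ε`, then the
derivative of the rotation from `μ` to the Gaussian law is of order `ε`: the two second order
terms cancel. -/
lemma abs_integral_rotation_deriv_le [IsProbabilityMeasure μ] (hμ : Integrable (fun x => ‖x‖) μ)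
    (hS : S.PosSemidef) {ε : ℝ}
    (hstein : ∀ h h', HasBoundedPartials h h' → ∀ i,
      |∫ x, x i * h x ∂μ - ∑ j, S i j * ∫ x, h' j x ∂μ| ≤ ε)
    {h : EuclideanSpace ℝ (Fin d) → ℝ} {h' : Fin d → EuclideanSpace ℝ (Fin d) → ℝ}
    (hh : HasBoundedPartials h h') (hb : ∀ x, |h x| ≤ 1) (i : Fin d) (s : ℝ) :
    |∫ z, h (Real.cos s • z.1 + Real.sin s • z.2) * (-Real.sin s * z.1 i + Real.cos s * z.2 i)
      ∂(μ.prod (multivariateGaussian 0 S))| ≤ ε := by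
  set γ := multivariateGaussian 0 S
  have hc := hh.continuous
  have hε : 0 ≤ ε := (abs_nonneg _).trans (hstein h h' hh i)
  have hγ : Integrable (fun y : EuclideanSpace ℝ (Fin d) => ‖y‖) γ :=
    IsGaussian.integrable_id.norm
  have I1 : Integrable (fun z : EuclideanSpace ℝ (Fin d) × EuclideanSpace ℝ (Fin d) =>
      z.1 i * h (Real.cos s • z.1 + Real.sin s • z.2)) (μ.prod γ) := by
    refine Integrable.mono' (hμ.comp_fst γ) (Continuous.aestronglyMeasurable (by fun_prop))
      (Eventually.of_forall fun z => ?_)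
    rw [norm_mul]
    exact (mul_le_of_le_one_right (norm_nonneg _) (hb _)).trans (PiLp.norm_apply_le z.1 i)
  have I2 : Integrable (fun z : EuclideanSpace ℝ (Fin d) × EuclideanSpace ℝ (Fin d) =>
      z.2 i * h (Real.cos s • z.1 + Real.sin s • z.2)) (μ.prod γ) := by
    refine Integrable.mono' (hγ.comp_snd μ) (Continuous.aestronglyMeasurable (by fun_prop))
      (Eventually.of_forall fun z => ?_)
    rw [norm_mul]
    exact (mul_le_of_le_one_right (norm_nonneg _) (hb _)).trans (PiLp.norm_apply_le z.2 i)
  have I3 : ∀ j, Integrable (fun z : EuclideanSpace ℝ (Fin d) × EuclideanSpace ℝ (Fin d) =>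
      h' j (Real.cos s • z.1 + Real.sin s • z.2)) (μ.prod γ) := fun j => by
    have := hh.continuous_partial j
    exact Integrable.mono' (integrable_const 1) (Continuous.aestronglyMeasurable (by fun_prop))
      (Eventually.of_forall fun z => hh.bound j _)
  set X := ∑ j, S i j * ∫ z, h' j (Real.cos s • z.1 + Real.sin s • z.2) ∂(μ.prod γ) with hX
  have E2 : ∫ z, z.2 i * h (Real.cos s • z.1 + Real.sin s • z.2) ∂(μ.prod γ) =
      Real.sin s * X := by
    have hx : ∀ x : EuclideanSpace ℝ (Fin d),
        ∫ y, y i * h (Real.cos s • x + Real.sin s • y) ∂γ =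
          ∑ j, S i j * ∫ y, Real.sin s * h' j (Real.cos s • x + Real.sin s • y) ∂γ := fun x => by
      have := (hh.comp_smul_add (Real.abs_sin_le_one s)
        (Real.cos s • x)).integral_coord_mul_multivariateGaussian hS i
      simpa only [add_comm] using this
    rw [integral_prod _ I2]
    simp only [hx]
    rw [integral_finsetSum _ fun j _ => ((I3 j).integral_prod_left.const_mul (Real.sin s)
      |>.const_mul (S i j)).congr (Eventually.of_forall fun x => by
        simp only [integral_const_mul]), hX, Finset.mul_sum]
    refine Finset.sum_congr rfl fun j _ => ?_
    simp only [integral_const_mul, integral_prod _ (I3 j)]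
    ring
  have E1 : |∫ z, z.1 i * h (Real.cos s • z.1 + Real.sin s • z.2) ∂(μ.prod γ) -
      Real.cos s * X| ≤ ε := by
    have hy : ∀ y : EuclideanSpace ℝ (Fin d),
        |∫ x, x i * h (Real.cos s • x + Real.sin s • y) ∂μ -
          ∑ j, S i j * ∫ x, Real.cos s * h' j (Real.cos s • x + Real.sin s • y) ∂μ| ≤ ε :=
      fun y => hstein _ _ (hh.comp_smul_add (Real.abs_cos_le_one s) (Real.sin s • y)) i
    have J : ∀ j, Integrable (fun y => S i j *
        ∫ x, Real.cos s * h' j (Real.cos s • x + Real.sin s • y) ∂μ) γ := fun j =>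
      ((I3 j).integral_prod_right.const_mul (Real.cos s) |>.const_mul (S i j)).congr
        (Eventually.of_forall fun y => by simp only [integral_const_mul])
    have hXe : Real.cos s * X = ∫ y, ∑ j, S i j *
        ∫ x, Real.cos s * h' j (Real.cos s • x + Real.sin s • y) ∂μ ∂γ := by
      rw [integral_finsetSum _ fun j _ => J j, hX, Finset.mul_sum]
      refine Finset.sum_congr rfl fun j _ => ?_
      simp only [integral_const_mul, integral_prod_symm _ (I3 j)]
      ring
    rw [integral_prod_symm _ I1, hXe, ← integral_sub I1.integral_prod_right
      (integrable_finsetSum _ fun j _ => J j), ← Real.norm_eq_abs]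
    refine (norm_integral_le_of_norm_le_const (C := ε) (Eventually.of_forall fun y =>
      (Real.norm_eq_abs _).trans_le (hy y))).trans (le_of_eq ?_)
    simp
  have E : ∫ z, h (Real.cos s • z.1 + Real.sin s • z.2) *
      (-Real.sin s * z.1 i + Real.cos s * z.2 i) ∂(μ.prod γ) =
      -Real.sin s * (∫ z, z.1 i * h (Real.cos s • z.1 + Real.sin s • z.2) ∂(μ.prod γ) -
        Real.cos s * X) := by
    calc _ = ∫ z, (-Real.sin s * (z.1 i * h (Real.cos s • z.1 + Real.sin s • z.2)) +
          Real.cos s * (z.2 i * h (Real.cos s • z.1 + Real.sin s • z.2))) ∂(μ.prod γ) := by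
          congr 1; funext z; ring
      _ = _ := by
          rw [integral_add (I1.const_mul _) (I2.const_mul _), integral_const_mul,
            integral_const_mul, E2]
          ring
  rw [E, abs_mul, abs_neg]
  exact (mul_le_of_le_one_left (abs_nonneg _) (Real.abs_sin_le_one s)).trans E1

/-- A law satisfying the Gaussian integration by parts formula up to an error `ε` is close to the
Gaussian law, tested against the test functions of the `d_4`-distance. -/
theorem abs_integral_sub_integral_multivariateGaussian_le [IsProbabilityMeasure μ]
    (hμ : Integrable (fun x => ‖x‖) μ) (hS : S.PosSemidef) {ε : ℝ}
    (hstein : ∀ h h', HasBoundedPartials h h' → ∀ i,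
      |∫ x, x i * h x ∂μ - ∑ j, S i j * ∫ x, h' j x ∂μ| ≤ ε)
    {g : EuclideanSpace ℝ (Fin d) → ℝ} (hg : D4TestFunction g) :
    |∫ x, g x ∂μ - ∫ x, g x ∂(multivariateGaussian 0 S)| ≤ Real.pi / 2 * (d * ε) := by
  set γ := multivariateGaussian 0 S
  have hg0 : HasBoundedPartials g fun j => iterPartialDeriv [j] g :=
    hg.hasBoundedPartials [] (by simp)
  have hg1 : ∀ i, HasBoundedPartials (iterPartialDeriv [i] g)
      fun j => iterPartialDeriv [j, i] g := fun i => hg.hasBoundedPartials [i] (by simp)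
  have hγ : Integrable (fun y : EuclideanSpace ℝ (Fin d) => ‖y‖) γ :=
    IsGaussian.integrable_id.norm
  have hc := hg0.continuous
  have hc1 := fun i => (hg1 i).continuous
  let G' : ℝ → EuclideanSpace ℝ (Fin d) × EuclideanSpace ℝ (Fin d) → ℝ := fun s z =>
    ∑ i, iterPartialDeriv [i] g (Real.cos s • z.1 + Real.sin s • z.2) *
      (-Real.sin s * z.1 i + Real.cos s * z.2 i)
  have hbound : ∀ i s (z : EuclideanSpace ℝ (Fin d) × EuclideanSpace ℝ (Fin d)),
      ‖iterPartialDeriv [i] g (Real.cos s • z.1 + Real.sin s • z.2) *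
        (-Real.sin s * z.1 i + Real.cos s * z.2 i)‖ ≤ ‖z.1‖ + ‖z.2‖ := fun i s z => by
    rw [norm_mul]
    refine (mul_le_of_le_one_left (norm_nonneg _) (hg0.bound i _)).trans ?_
    refine (norm_add_le _ _).trans (add_le_add ?_ ?_)
    · rw [norm_mul, norm_neg]
      exact (mul_le_of_le_one_left (norm_nonneg _) (Real.abs_sin_le_one s)).trans
        (PiLp.norm_apply_le z.1 i)
    · rw [norm_mul]
      exact (mul_le_of_le_one_left (norm_nonneg _) (Real.abs_cos_le_one s)).trans
        (PiLp.norm_apply_le z.2 i)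
  have hint : Integrable (fun z : EuclideanSpace ℝ (Fin d) × EuclideanSpace ℝ (Fin d) =>
      ‖z.1‖ + ‖z.2‖) (μ.prod γ) := (hμ.comp_fst γ).add (hγ.comp_snd μ)
  have hderiv : ∀ s, HasDerivAt
      (fun s => ∫ z, g (Real.cos s • z.1 + Real.sin s • z.2) ∂(μ.prod γ))
      (∫ z, G' s z ∂(μ.prod γ)) s := by
    intro s
    refine (hasDerivAt_integral_of_dominated_loc_of_deriv_le (F' := G')
      (bound := fun z => ∑ _i : Fin d, (‖z.1‖ + ‖z.2‖)) univ_mem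
      (Eventually.of_forall fun t => Continuous.aestronglyMeasurable (by fun_prop)) ?_
      (Continuous.aestronglyMeasurable (by fun_prop))
      (Eventually.of_forall fun z t _ => norm_sum_le_of_le _ fun i _ => hbound i t z)
      (integrable_finsetSum _ fun _ _ => hint)
      (Eventually.of_forall fun z t _ => ?_)).2
    · refine Integrable.mono' (g := fun z => |g 0| + d * (‖z.1‖ + ‖z.2‖))
        ((integrable_const _).add (hint.const_mul _))
        (Continuous.aestronglyMeasurable (by fun_prop)) (Eventually.of_forall fun z => ?_)
      refine (hg0.abs_le _).trans ?_
      gcongr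
      refine (norm_add_le _ _).trans (add_le_add ?_ ?_)
      · rw [norm_smul]
        exact mul_le_of_le_one_left (norm_nonneg _) (Real.abs_cos_le_one s)
      · rw [norm_smul]
        exact mul_le_of_le_one_left (norm_nonneg _) (Real.abs_sin_le_one s)
    · refine (hg0.hasDerivAt_comp (hasDerivAt_rotation z.1 z.2 t)).congr_deriv ?_
      simp [G']
  have hle : ∀ s, ‖∫ z, G' s z ∂(μ.prod γ)‖ ≤ d * ε := by
    intro s
    rw [integral_finsetSum _ fun i _ => Integrable.mono' hint
      (Continuous.aestronglyMeasurable (by fun_prop)) (Eventually.of_forall (hbound i s))]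
    refine (norm_sum_le_of_le (n := fun _ => ε) _ fun i _ =>
      abs_integral_rotation_deriv_le hμ hS hstein (hg1 i) (hg0.bound i) i s).trans (le_of_eq ?_)
    simp
  have := convex_univ.norm_image_sub_le_of_norm_hasDerivWithin_le
    (fun s _ => (hderiv s).hasDerivWithinAt) (fun s _ => hle s)
    (Set.mem_univ (Real.pi / 2)) (Set.mem_univ 0)
  simp only [Real.cos_zero, Real.sin_zero, Real.cos_pi_div_two, Real.sin_pi_div_two, one_smul,
    zero_smul, add_zero, zero_add, integral_fun_fst, integral_fun_snd, probReal_univ,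
    Real.norm_eq_abs, zero_sub, abs_neg, abs_of_pos Real.pi_div_two_pos] at this
  linarith [this, mul_comm (Real.pi / 2) (d * ε)]

end Interpolation

/-! ### Independence of a vertex star from the rest of the random graph -/

section Star

open Classical SimpleGraph

variable {n : ℕ}

instance : MeasurableSingletonClass (SimpleGraph (Fin n)) where
  measurableSet_singleton G := by
    have : ({G} : Set (SimpleGraph (Fin n))) = edgeSet ⁻¹' {G.edgeSet} := by
      ext H; simp
    rw [this]
    exact measurable_edgeSet (measurableSet_singleton _)

/-- The set of neighbours of `v` in `G`. -/
noncomputable def nbhd (v : Fin n) (G : SimpleGraph (Fin n)) : Finset (Fin n) := G.neighborFinset v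

lemma mem_nbhd {v w : Fin n} {G : SimpleGraph (Fin n)} : w ∈ nbhd v G ↔ G.Adj v w := by
  simp [nbhd]

/-- The star with centre `v` and leaves `S \ {v}`. -/
noncomputable def starGraph (v : Fin n) (S : Finset (Fin n)) : SimpleGraph (Fin n) :=
  SimpleGraph.fromRel fun a b => a = v ∧ b ∈ S

/-- A graph is the same as its restriction to the complement of `v` together with the set of
neighbours of `v`. -/
lemma sum_simpleGraph_eq_sum_deleteIncidenceSet (v : Fin n)
    (φ : SimpleGraph (Fin n) → Finset (Fin n) → ℝ) :
    ∑ G : SimpleGraph (Fin n), φ (G.deleteIncidenceSet v) (nbhd v G) =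
      ∑ H : SimpleGraph (Fin n) with ∀ w, ¬ H.Adj v w,
        ∑ S ∈ (Finset.univ.erase v).powerset, φ H S := by
  rw [← Finset.sum_product']
  refine Finset.sum_bij' (fun G _ => (G.deleteIncidenceSet v, nbhd v G))
    (fun x _ => x.1 ⊔ starGraph v x.2) ?_ (fun _ _ => Finset.mem_univ _) ?_ ?_ (fun _ _ => rfl)
  · intro G _
    simp [deleteIncidenceSet_adj, Finset.subset_iff, mem_nbhd]
    exact fun w hw => hw.ne'
  · intro G _
    ext a b
    simp only [sup_adj, deleteIncidenceSet_adj, starGraph, fromRel_adj, mem_nbhd]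
    grind [G.adj_comm, G.ne_of_adj]
  · rintro ⟨H, S⟩ h
    simp only [Finset.mem_product, Finset.mem_filter, Finset.mem_univ, true_and,
      Finset.mem_powerset, Finset.subset_erase] at h
    obtain ⟨hH, -, hv⟩ := h
    have hH' : ∀ w, ¬ H.Adj w v := fun w hw => hH w hw.symm
    refine Prod.ext ?_ ?_
    · ext a b
      simp only [sup_adj, deleteIncidenceSet_adj, starGraph, fromRel_adj]
      grind
    · ext a
      rw [mem_nbhd]
      simp only [sup_adj, starGraph, fromRel_adj]
      grind

lemma ncard_edgeSet_eq_add_degree (G : SimpleGraph (Fin n)) (v : Fin n) :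
    G.edgeSet.ncard = (G.deleteIncidenceSet v).edgeSet.ncard + (nbhd v G).card := by
  have h1 := card_edgeFinset_deleteIncidenceSet G v
  have h2 : G.degree v ≤ G.edgeFinset.card := by
    rw [← card_incidenceFinset_eq_degree]
    exact Finset.card_le_card (incidenceFinset_subset G v)
  rw [nbhd, card_neighborFinset_eq_degree, ← coe_edgeFinset, ← coe_edgeFinset, Set.ncard_coe_finset,
    Set.ncard_coe_finset]
  have h3 : ((G.deleteIncidenceSet v).edgeFinset).card = G.edgeFinset.card - G.degree v := by
    convert! h1
  omega

variable {p : unitInterval}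

lemma binomialRandom_real_singleton (hp : (p : ℝ) < 1) (G : SimpleGraph (Fin n)) :
    (binomialRandom (Fin n) p).real {G} =
      (1 - p : ℝ) ^ (n.choose 2) * ((p : ℝ) / (1 - p)) ^ G.edgeSet.ncard := by
  have h1 : G.edgeSet.ncard ≤ n.choose 2 := by
    rw [← coe_edgeFinset, Set.ncard_coe_finset]
    simpa using card_edgeFinset_le_card_choose_two (G := G)
  have hq : (1 - p : ℝ) ≠ 0 := by linarith
  rw [measureReal_def, binomialRandom_singleton]
  simp only [ENNReal.toReal_mul, ENNReal.toReal_pow, ENNReal.coe_toReal, Nat.card_eq_fintype_card,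
    Fintype.card_fin, unitInterval.coe_toNNReal, unitInterval.coe_symm_eq]
  rw [div_pow, pow_sub₀ _ hq h1]
  field_simp

/-- The neighbours of `v` and the graph outside `v` have, up to normalisation, a product law. -/
lemma integral_star_eq_mul_sum (hp : (p : ℝ) < 1) (v : Fin n) (a : Finset (Fin n) → ℝ)
    (b : SimpleGraph (Fin n) → ℝ) :
    ∫ G, a (nbhd v G) * b (G.deleteIncidenceSet v) ∂(binomialRandom (Fin n) p) =
      (∑ S ∈ (Finset.univ.erase v).powerset, ((p : ℝ) / (1 - p)) ^ S.card * a S) *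
      ∑ H : SimpleGraph (Fin n) with ∀ w, ¬ H.Adj v w,
        (1 - p : ℝ) ^ (n.choose 2) * ((p : ℝ) / (1 - p)) ^ H.edgeSet.ncard * b H := by
  rw [integral_fintype .of_finite, Finset.sum_mul_sum, Finset.sum_comm,
    ← sum_simpleGraph_eq_sum_deleteIncidenceSet v (fun H S => ((p : ℝ) / (1 - p)) ^ S.card * a S *
      ((1 - p : ℝ) ^ (n.choose 2) * ((p : ℝ) / (1 - p)) ^ H.edgeSet.ncard * b H))]
  refine Finset.sum_congr rfl fun G _ => ?_
  rw [binomialRandom_real_singleton hp, ncard_edgeSet_eq_add_degree G v, smul_eq_mul]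
  ring

/-- The set of neighbours of `v` is independent of the graph outside `v`. -/
lemma integral_star_mul (hp : (p : ℝ) < 1) (v : Fin n) (a : Finset (Fin n) → ℝ)
    (b : SimpleGraph (Fin n) → ℝ) :
    ∫ G, a (nbhd v G) * b (G.deleteIncidenceSet v) ∂(binomialRandom (Fin n) p) =
      (∫ G, a (nbhd v G) ∂(binomialRandom (Fin n) p)) *
      ∫ G, b (G.deleteIncidenceSet v) ∂(binomialRandom (Fin n) p) := by
  have h1 := integral_star_eq_mul_sum (n := n) hp v (fun _ => 1) (fun _ => 1)
  have h2 := integral_star_eq_mul_sum (n := n) hp v a (fun _ => 1)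
  have h3 := integral_star_eq_mul_sum (n := n) hp v (fun _ => 1) b
  have h4 := integral_star_eq_mul_sum (n := n) hp v a b
  simp only [mul_one, one_mul, integral_const, probReal_univ, smul_eq_mul] at h1 h2 h3 h4
  rw [h4, h2, h3]
  linear_combination (∑ S ∈ (Finset.univ.erase v).powerset, ((p : ℝ) / (1 - p)) ^ S.card * a S) *
      (∑ H : SimpleGraph (Fin n) with ∀ w, ¬ H.Adj v w,
        (1 - p : ℝ) ^ (n.choose 2) * ((p : ℝ) / (1 - p)) ^ H.edgeSet.ncard * b H) * h1

/-- The law of the set of neighbours of `v`. -/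
lemma integral_nbhd (hp : (p : ℝ) < 1) (v : Fin n) (a : Finset (Fin n) → ℝ) :
    ∫ G, a (nbhd v G) ∂(binomialRandom (Fin n) p) =
      ∑ S ∈ (Finset.univ.erase v).powerset,
        (p : ℝ) ^ S.card * (1 - p : ℝ) ^ (n - 1 - S.card) * a S := by
  have hq : (1 - p : ℝ) ≠ 0 := by linarith
  have h1 := integral_star_eq_mul_sum (n := n) hp v (fun _ => 1) (fun _ => 1)
  have h2 := integral_star_eq_mul_sum (n := n) hp v a (fun _ => 1)
  simp only [mul_one, integral_const, probReal_univ, smul_eq_mul] at h1 h2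
  have hcard : (Finset.univ.erase v).card = n - 1 := by simp
  have hw : ∀ S ∈ (Finset.univ.erase v).powerset, (p : ℝ) ^ S.card * (1 - p : ℝ) ^ (n - 1 - S.card)
      = (1 - p : ℝ) ^ (n - 1) * ((p : ℝ) / (1 - p)) ^ S.card := by
    intro S hS
    have := Finset.card_le_card (Finset.mem_powerset.1 hS)
    rw [hcard] at this
    rw [div_pow, pow_sub₀ _ hq this]
    ring
  have h3 : (1 - p : ℝ) ^ (n - 1) * ∑ S ∈ (Finset.univ.erase v).powerset,
      ((p : ℝ) / (1 - p)) ^ S.card = 1 := by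
    rw [Finset.mul_sum, ← Finset.sum_congr rfl hw, ← hcard, Finset.sum_pow_mul_eq_add_pow]
    simp
  have h4 : ∑ S ∈ (Finset.univ.erase v).powerset,
      (p : ℝ) ^ S.card * (1 - p : ℝ) ^ (n - 1 - S.card) * a S = (1 - p : ℝ) ^ (n - 1) *
        ∑ S ∈ (Finset.univ.erase v).powerset, ((p : ℝ) / (1 - p)) ^ S.card * a S := by
    rw [Finset.mul_sum]
    exact Finset.sum_congr rfl fun S hS => by rw [hw S hS, mul_assoc]
  rw [h4, h2]
  set A := ∑ S ∈ (Finset.univ.erase v).powerset, ((p : ℝ) / (1 - p)) ^ S.card * a S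
  set A1 := ∑ S ∈ (Finset.univ.erase v).powerset, ((p : ℝ) / (1 - p)) ^ S.card
  set B := ∑ H : SimpleGraph (Fin n) with ∀ w, ¬ H.Adj v w,
        (1 - p : ℝ) ^ (n.choose 2) * ((p : ℝ) / (1 - p)) ^ H.edgeSet.ncard
  linear_combination (-A * B) * h3 + (-(1 - p : ℝ) ^ (n - 1) * A) * h1

/-- The probability `binomial (n - 1, p) {i}` that a given vertex has degree `i`. -/
noncomputable def degreeProb (n : ℕ) (p : ℝ) (i : ℕ) : ℝ :=
  (n - 1).choose i * p ^ i * (1 - p) ^ (n - 1 - i)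

lemma integral_degree_eq (hp : (p : ℝ) < 1) (v : Fin n) (i : ℕ) :
    ∫ G, (if (nbhd v G).card = i then (1 : ℝ) else 0)
      ∂(binomialRandom (Fin n) p) = degreeProb n p i := by
  rw [integral_nbhd hp v fun S => if S.card = i then (1 : ℝ) else 0]
  rw [Finset.sum_powerset_apply_card (fun m => (p : ℝ) ^ m * (1 - p : ℝ) ^ (n - 1 - m) *
    if m = i then (1 : ℝ) else 0)]
  simp only [mul_ite, mul_one, mul_zero, smul_ite, smul_zero, Finset.sum_ite_eq',
    Finset.card_erase_of_mem, Finset.mem_univ, Finset.card_univ, Fintype.card_fin, nsmul_eq_mul, degreeProb]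
  split_ifs with h
  · ring
  · rw [Nat.choose_eq_zero_of_lt (by simpa [Nat.lt_succ_iff] using h)]
    simp

/-- Expectations of functions of the degree of `v` on the event that `w` is adjacent to `v`. -/
lemma integral_degree_mul_adj (hp : (p : ℝ) < 1) {v w : Fin n} (hvw : w ≠ v) (a : ℕ → ℝ) :
    ∫ G, a (nbhd v G).card *
      (if w ∈ nbhd v G then (1 : ℝ) else 0) ∂(binomialRandom (Fin n) p) =
      ∑ m ∈ Finset.range (n - 1), (n - 2).choose m •
        ((p : ℝ) ^ (m + 1) * (1 - p : ℝ) ^ (n - 1 - (m + 1)) * a (m + 1)) := by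
  rw [integral_nbhd hp v fun S => a S.card * if w ∈ S then (1 : ℝ) else 0]
  have hw : w ∈ Finset.univ.erase v := by simp [hvw]
  have hn : 2 ≤ n := by
    have := Finset.card_pos.2 ⟨w, hw⟩
    simp at this
    omega
  have hcard : ((Finset.univ.erase v).erase w).card = n - 2 := by
    rw [Finset.card_erase_of_mem hw]; simp; omega
  conv_lhs => rw [← Finset.insert_erase hw]
  rw [Finset.sum_powerset_insert (by simp)]
  rw [Finset.sum_eq_zero, zero_add]
  · rw [Finset.sum_congr rfl (g := fun S => (p : ℝ) ^ (S.card + 1) *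
      (1 - p : ℝ) ^ (n - 1 - (S.card + 1)) * a (S.card + 1)), Finset.sum_powerset_apply_card
      (fun m => (p : ℝ) ^ (m + 1) * (1 - p : ℝ) ^ (n - 1 - (m + 1)) * a (m + 1)), hcard]
    · rw [show n - 2 + 1 = n - 1 by omega]
    · intro S hS
      have : w ∉ S := fun h => by simpa using Finset.mem_powerset.1 hS h
      rw [Finset.card_insert_of_notMem this]
      simp
  · intro S hS
    have : w ∉ S := fun h => by simpa using Finset.mem_powerset.1 hS h
    simp [this]

lemma integral_adj (hp : (p : ℝ) < 1) {v w : Fin n} (hvw : w ≠ v) :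
    ∫ G, (if w ∈ nbhd v G then (1 : ℝ) else 0) ∂(binomialRandom (Fin n) p) =
      p := by
  have h := integral_degree_mul_adj hp hvw fun _ => 1
  simp only [one_mul, mul_one] at h
  have hn : 2 ≤ n := by
    have h1 := v.2; have h2 := w.2; have h3 : w.1 ≠ v.1 := fun e => hvw (Fin.ext e)
    omega
  rw [h, show n - 1 = n - 2 + 1 by omega]
  have := add_pow (p : ℝ) (1 - p) (n - 2)
  rw [add_sub_cancel, one_pow] at this
  calc _ = (p : ℝ) * ∑ m ∈ Finset.range (n - 2 + 1), (p : ℝ) ^ m * (1 - p) ^ (n - 2 - m) *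
        (n - 2).choose m := by
        rw [Finset.mul_sum]
        refine Finset.sum_congr rfl fun m _ => ?_
        rw [show n - 2 + 1 - (m + 1) = n - 2 - m by omega, nsmul_eq_mul]
        ring
    _ = p := by rw [← this, mul_one]

lemma integral_degree_eq_mul_adj (hp : (p : ℝ) < 1) {v w : Fin n} (hvw : w ≠ v) {i : ℕ}
    (hi : 1 ≤ i) :
    ∫ G, (if (nbhd v G).card = i then (1 : ℝ) else 0) *
      (if w ∈ nbhd v G then (1 : ℝ) else 0) ∂(binomialRandom (Fin n) p) =
      i * degreeProb n p i / (n - 1) := by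
  have hn : 2 ≤ n := by
    have h1 := v.2; have h2 := w.2; have h3 : w.1 ≠ v.1 := fun e => hvw (Fin.ext e)
    omega
  obtain ⟨k, rfl⟩ : ∃ k, i = k + 1 := ⟨i - 1, by omega⟩
  obtain ⟨m, rfl⟩ : ∃ m, n = m + 2 := ⟨n - 2, by omega⟩
  rw [integral_degree_mul_adj hp hvw fun m => if m = k + 1 then (1 : ℝ) else 0]
  simp only [mul_ite, mul_one, mul_zero, smul_ite, smul_zero, add_left_inj, Finset.sum_ite_eq',
    Finset.mem_range, nsmul_eq_mul, degreeProb]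
  have hch : ((m : ℝ) + 1) * (m.choose k) = ((m + 1).choose (k + 1) : ℝ) * (k + 1) := by
    exact_mod_cast Nat.add_one_mul_choose_eq m k
  have hm : ((m + 2 : ℕ) : ℝ) - 1 = m + 1 := by push_cast; ring
  have hm0 : (m : ℝ) + 1 ≠ 0 := by positivity
  rw [hm, eq_div_iff hm0]
  simp only [Nat.add_sub_cancel, show m + 2 - 1 = m + 1 by omega]
  split_ifs with h
  · rw [Nat.add_sub_add_right]
    push_cast
    linear_combination (p : ℝ) ^ (k + 1) * (1 - p : ℝ) ^ (m - k) * hch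
  · rw [Nat.choose_eq_zero_of_lt (by omega)]
    simp

/-- The exponential moment controls all moments of the degree. -/
lemma integral_two_pow_degree (hp : (p : ℝ) < 1) (v : Fin n) :
    ∫ G, (2 : ℝ) ^ (nbhd v G).card ∂(binomialRandom (Fin n) p) =
      (1 + p : ℝ) ^ (n - 1) := by
  rw [integral_nbhd hp v fun S => (2 : ℝ) ^ S.card]
  have := Finset.sum_pow_mul_eq_add_pow (2 * p : ℝ) (1 - p) (Finset.univ.erase v)
  rw [show (2 * p + (1 - p) : ℝ) = 1 + p by ring] at this
  simp only [Finset.card_erase_of_mem (Finset.mem_univ v), Finset.card_univ, Fintype.card_fin]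
    at this
  rw [← this]
  exact Finset.sum_congr rfl fun S _ => by rw [mul_pow]; ring

end Star

/-! ### Degree counts after the removal of a vertex -/

section Counts

open Classical SimpleGraph

variable {n : ℕ}

lemma degreeCount_eq_sum (i : ℕ) (G : SimpleGraph (Fin n)) :
    (degreeCount i G : ℝ) = ∑ v, if (nbhd v G).card = i then (1 : ℝ) else 0 := by
  rw [Finset.sum_boole]
  rfl

lemma nbhd_deleteIncidenceSet_self (v : Fin n) (G : SimpleGraph (Fin n)) :
    nbhd v (G.deleteIncidenceSet v) = ∅ := by
  ext w
  simp [mem_nbhd, deleteIncidenceSet_adj]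

lemma card_nbhd_eq_add (G : SimpleGraph (Fin n)) {v w : Fin n} (hvw : w ≠ v) :
    (nbhd w G).card = (nbhd w (G.deleteIncidenceSet v)).card + if w ∈ nbhd v G then 1 else 0 := by
  have h1 : nbhd w (G.deleteIncidenceSet v) = (nbhd w G).erase v := by
    ext u
    simp [mem_nbhd, deleteIncidenceSet_adj]
    tauto
  rw [h1]
  split_ifs with h
  · have : v ∈ nbhd w G := mem_nbhd.2 (mem_nbhd.1 h).symm
    rw [Finset.card_erase_add_one this]
  · have : v ∉ nbhd w G := fun hv => h (mem_nbhd.2 (mem_nbhd.1 hv).symm)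
    rw [Finset.erase_eq_of_notMem this, add_zero]

/-- The effect on the degree counts of attaching the vertex `v` to the graph outside `v`. -/
lemma degreeCount_sub_degreeCount_deleteIncidenceSet (j : ℕ) (v : Fin n)
    (G : SimpleGraph (Fin n)) :
    (degreeCount j G : ℝ) - degreeCount j (G.deleteIncidenceSet v) =
      (if (nbhd v G).card = j then (1 : ℝ) else 0) - (if 0 = j then (1 : ℝ) else 0) +
      ∑ w ∈ Finset.univ.erase v, (if w ∈ nbhd v G then (1 : ℝ) else 0) *
        ((if (nbhd w (G.deleteIncidenceSet v)).card + 1 = j then (1 : ℝ) else 0) -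
          if (nbhd w (G.deleteIncidenceSet v)).card = j then (1 : ℝ) else 0) := by
  rw [degreeCount_eq_sum, degreeCount_eq_sum, ← Finset.add_sum_erase _ _ (Finset.mem_univ v),
    ← Finset.add_sum_erase (a := v) Finset.univ (fun w =>
      if (nbhd w (G.deleteIncidenceSet v)).card = j then (1 : ℝ) else 0) (Finset.mem_univ v),
    nbhd_deleteIncidenceSet_self, Finset.card_empty]
  have : ∑ w ∈ Finset.univ.erase v, (if (nbhd w G).card = j then (1 : ℝ) else 0) -
      ∑ w ∈ Finset.univ.erase v, (if (nbhd w (G.deleteIncidenceSet v)).card = j then (1 : ℝ) else 0)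
      = ∑ w ∈ Finset.univ.erase v, (if w ∈ nbhd v G then (1 : ℝ) else 0) *
        ((if (nbhd w (G.deleteIncidenceSet v)).card + 1 = j then (1 : ℝ) else 0) -
          if (nbhd w (G.deleteIncidenceSet v)).card = j then (1 : ℝ) else 0) := by
    rw [← Finset.sum_sub_distrib]
    refine Finset.sum_congr rfl fun w hw => ?_
    rw [card_nbhd_eq_add G (Finset.ne_of_mem_erase hw)]
    by_cases h : w ∈ nbhd v G <;> simp [h]
  linarith

lemma abs_ite_sub_ite_le_one (P Q : Prop) [Decidable P] [Decidable Q] :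
    |(if P then (1 : ℝ) else 0) - if Q then (1 : ℝ) else 0| ≤ 1 := by
  split_ifs <;> simp

lemma abs_degreeCount_sub_le (j : ℕ) (v : Fin n) (G : SimpleGraph (Fin n)) :
    |(degreeCount j G : ℝ) - degreeCount j (G.deleteIncidenceSet v)| ≤ 1 + (nbhd v G).card := by
  rw [degreeCount_sub_degreeCount_deleteIncidenceSet]
  refine (abs_add_le _ _).trans (add_le_add (abs_ite_sub_ite_le_one _ _) ?_)
  refine (Finset.abs_sum_le_sum_abs _ _).trans ?_
  calc _ ≤ ∑ w ∈ Finset.univ.erase v, if w ∈ nbhd v G then (1 : ℝ) else 0 := by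
        refine Finset.sum_le_sum fun w _ => ?_
        rw [abs_mul]
        have := abs_ite_sub_ite_le_one ((nbhd w (G.deleteIncidenceSet v)).card + 1 = j)
          ((nbhd w (G.deleteIncidenceSet v)).card = j)
        split_ifs at this ⊢ <;> simp
    _ ≤ ∑ w, if w ∈ nbhd v G then (1 : ℝ) else 0 :=
        Finset.sum_le_sum_of_subset_of_nonneg (Finset.subset_univ _) fun w _ _ => by positivity
    _ = _ := by simp

/-- The neighbour terms, summed over all vertices other than the isolated vertex `v`, are degree
counts again. -/
lemma sum_erase_degree_indicators {j : ℕ} (hj : 1 ≤ j) (v : Fin n) (G : SimpleGraph (Fin n)) :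
    ∑ w ∈ Finset.univ.erase v,
        ((if (nbhd w (G.deleteIncidenceSet v)).card + 1 = j then (1 : ℝ) else 0) -
          if (nbhd w (G.deleteIncidenceSet v)).card = j then (1 : ℝ) else 0) =
      (degreeCount (j - 1) (G.deleteIncidenceSet v) : ℝ) - degreeCount j (G.deleteIncidenceSet v) -
        if j = 1 then 1 else 0 := by
  rw [degreeCount_eq_sum, degreeCount_eq_sum, ← Finset.sum_sub_distrib,
    ← Finset.add_sum_erase _ _ (Finset.mem_univ v), nbhd_deleteIncidenceSet_self,
    Finset.card_empty, if_neg (by omega : ¬ 0 = j), add_sub_right_comm]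
  have h1 : ((if 0 = j - 1 then (1 : ℝ) else 0) - 0 - if j = 1 then (1 : ℝ) else 0) = 0 := by
    by_cases h : j = 1
    · simp [h]
    · rw [if_neg (by omega), if_neg h]; simp
  rw [h1, zero_add]
  refine Finset.sum_congr rfl fun w _ => ?_
  congr 2
  exact propext ⟨fun h => by omega, fun h => by omega⟩

end Counts

/-! ### Moments of degrees and degree counts -/

section Moments

open Classical SimpleGraph

variable {n : ℕ} {p : unitInterval} {θ : ℝ}

lemma degreeProb_mem_Icc (hp : (p : ℝ) < 1) (v : Fin n) (i : ℕ) :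
    degreeProb n p i ∈ Set.Icc (0 : ℝ) 1 := by
  rw [← integral_degree_eq hp v i]
  refine ⟨integral_nonneg fun G => by positivity, ?_⟩
  calc _ ≤ ∫ _G, (1 : ℝ) ∂(binomialRandom (Fin n) p) :=
        integral_mono .of_finite .of_finite fun G => by
          show (if _ then (1 : ℝ) else 0) ≤ 1
          split_ifs <;> simp
    _ = 1 := by simp

lemma one_add_sq_le_four_mul_two_pow (k : ℕ) : (1 + (k : ℝ)) ^ 2 ≤ 4 * 2 ^ k := by
  have h : (1 + k) ^ 2 ≤ 4 * 2 ^ k := by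
    induction k using Nat.strong_induction_on with
    | _ k ih =>
      match k with
      | 0 => norm_num
      | 1 => norm_num
      | 2 => norm_num
      | k + 3 =>
        have := ih (k + 2) (by omega)
        rw [show k + 3 = k + 2 + 1 by omega, pow_succ 2 (k + 2)]
        generalize 2 ^ (k + 2) = X at this ⊢
        calc (1 + (k + 2 + 1)) ^ 2 ≤ 2 * (1 + (k + 2)) ^ 2 := by ring_nf; omega
          _ ≤ 4 * (X * 2) := by omega
  exact_mod_cast h

lemma integral_one_add_degree_sq_le (hp : (p : ℝ) < 1) (hpθ : (p : ℝ) * (n - 1) = θ) (v : Fin n) :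
    ∫ G, (1 + ((nbhd v G).card : ℝ)) ^ 2 ∂(binomialRandom (Fin n) p) ≤ 4 * Real.exp θ := by
  have hn : 1 ≤ n := by have := v.2; omega
  calc _ ≤ ∫ G, 4 * (2 : ℝ) ^ (nbhd v G).card ∂(binomialRandom (Fin n) p) :=
        integral_mono .of_finite .of_finite fun G => one_add_sq_le_four_mul_two_pow _
    _ = 4 * (1 + p : ℝ) ^ (n - 1) := by rw [integral_const_mul, integral_two_pow_degree hp]
    _ ≤ 4 * Real.exp θ := by
        gcongr
        rw [← hpθ, mul_comm, show ((n : ℝ) - 1) = ((n - 1 : ℕ) : ℝ) by push_cast [hn]; ring,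
          Real.exp_nat_mul]
        have : (0 : ℝ) ≤ p := p.2.1
        exact pow_le_pow_left₀ (by linarith) (by linarith [Real.add_one_le_exp (p : ℝ)]) _

lemma integral_one_add_degree_le (hp : (p : ℝ) < 1) (hpθ : (p : ℝ) * (n - 1) = θ) (v : Fin n) :
    ∫ G, (1 + ((nbhd v G).card : ℝ)) ∂(binomialRandom (Fin n) p) ≤ 4 * Real.exp θ :=
  (integral_mono .of_finite .of_finite fun G => by
    show 1 + ((nbhd v G).card : ℝ) ≤ (1 + ((nbhd v G).card : ℝ)) ^ 2
    have : (0 : ℝ) ≤ (nbhd v G).card := by positivity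
    nlinarith).trans (integral_one_add_degree_sq_le hp hpθ v)

/-- The centred indicator that the vertex `v` has degree `i`, as a function of the set of
neighbours of `v`. -/
noncomputable def centredIndicator (n : ℕ) (p : unitInterval) (i : ℕ) (S : Finset (Fin n)) : ℝ :=
  (if S.card = i then (1 : ℝ) else 0) - degreeProb n p i

lemma abs_centredIndicator_le (hp : (p : ℝ) < 1) (v : Fin n) (i : ℕ) (S : Finset (Fin n)) :
    |centredIndicator n p i S| ≤ 1 := by
  obtain ⟨h0, h1⟩ := degreeProb_mem_Icc hp v i
  rw [centredIndicator, abs_le]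
  split_ifs <;> constructor <;> linarith

lemma integral_centredIndicator (hp : (p : ℝ) < 1) (v : Fin n) (i : ℕ) :
    ∫ G, centredIndicator n p i (nbhd v G) ∂(binomialRandom (Fin n) p) = 0 := by
  simp only [centredIndicator]
  rw [integral_sub .of_finite .of_finite, integral_degree_eq hp v i]
  simp

lemma integral_centredIndicator_mul (hp : (p : ℝ) < 1) (v : Fin n) (i : ℕ)
    (b : SimpleGraph (Fin n) → ℝ) :
    ∫ G, centredIndicator n p i (nbhd v G) * b (G.deleteIncidenceSet v)
      ∂(binomialRandom (Fin n) p) = 0 := by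
  rw [integral_star_mul hp v, integral_centredIndicator hp, zero_mul]

lemma integral_degreeCount (hp : (p : ℝ) < 1) (i : ℕ) :
    ∫ G, (degreeCount i G : ℝ) ∂(binomialRandom (Fin n) p) = n * degreeProb n p i := by
  simp only [degreeCount_eq_sum]
  rw [integral_finsetSum _ fun _ _ => .of_finite]
  simp only [integral_degree_eq hp]
  simp

lemma degreeCount_sub_eq_sum_centredIndicator (i : ℕ) (G : SimpleGraph (Fin n)) :
    (degreeCount i G : ℝ) - n * degreeProb n p i = ∑ v, centredIndicator n p i (nbhd v G) := by
  simp only [centredIndicator, Finset.sum_sub_distrib, degreeCount_eq_sum]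
  simp

/-- The variance of a degree count is of order `n`. -/
lemma integral_degreeCount_sub_sq_le (hp : (p : ℝ) < 1) (hpθ : (p : ℝ) * (n - 1) = θ) (i : ℕ) :
    ∫ G, ((degreeCount i G : ℝ) - n * degreeProb n p i) ^ 2 ∂(binomialRandom (Fin n) p) ≤
      n * (4 * Real.exp θ) := by
  -- one factor of the square is written as a sum of centred indicators; in the summand of `v` the
  -- other factor may be replaced by its increment, which is at most `1 + deg v`
  have h1 : ∀ G : SimpleGraph (Fin n), ((degreeCount i G : ℝ) - n * degreeProb n p i) ^ 2 =
      ∑ v, centredIndicator n p i (nbhd v G) * ((degreeCount i G : ℝ) - n * degreeProb n p i) :=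
    fun G => by rw [← Finset.sum_mul, ← degreeCount_sub_eq_sum_centredIndicator, sq]
  simp only [h1]
  rw [integral_finsetSum _ fun _ _ => .of_finite]
  calc _ ≤ ∑ _v : Fin n, 4 * Real.exp θ := Finset.sum_le_sum fun v _ => ?_
    _ = _ := by simp
  have h2 := integral_centredIndicator_mul hp v i fun H =>
    (degreeCount i H : ℝ) - n * degreeProb n p i
  calc _ = ∫ G, centredIndicator n p i (nbhd v G) *
        ((degreeCount i G : ℝ) - degreeCount i (G.deleteIncidenceSet v))
        ∂(binomialRandom (Fin n) p) := by
        rw [← sub_zero (integral _ _), ← h2, ← integral_sub .of_finite .of_finite]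
        congr 1
        funext G
        ring
    _ ≤ ∫ G, (1 + ((nbhd v G).card : ℝ)) ∂(binomialRandom (Fin n) p) :=
        integral_mono .of_finite .of_finite fun G => by
          refine (le_abs_self _).trans ?_
          rw [abs_mul]
          exact (mul_le_of_le_one_left (abs_nonneg _) (abs_centredIndicator_le hp v i _)).trans
            (abs_degreeCount_sub_le i v G)
    _ ≤ _ := integral_one_add_degree_le hp hpθ v

lemma integral_abs_degreeCount_sub_le (hp : (p : ℝ) < 1) (hpθ : (p : ℝ) * (n - 1) = θ)
    (hn : 1 ≤ n) (i : ℕ) :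
    ∫ G, |(degreeCount i G : ℝ) - n * degreeProb n p i| ∂(binomialRandom (Fin n) p) ≤
      √(n : ℝ) * (1 + 4 * Real.exp θ) := by
  have hs : 0 < √(n : ℝ) := Real.sqrt_pos.2 (by exact_mod_cast hn)
  have hs2 : √(n : ℝ) * √(n : ℝ) = n := Real.mul_self_sqrt (by positivity)
  -- `|X| ≤ √n + X² / √n` takes the place of the Cauchy–Schwarz inequality
  calc _ ≤ ∫ G, (√(n : ℝ) + (√(n : ℝ))⁻¹ * ((degreeCount i G : ℝ) - n * degreeProb n p i) ^ 2)
        ∂(binomialRandom (Fin n) p) := integral_mono .of_finite .of_finite fun G => by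
        show |(degreeCount i G : ℝ) - n * degreeProb n p i| ≤ √(n : ℝ) +
          (√(n : ℝ))⁻¹ * ((degreeCount i G : ℝ) - n * degreeProb n p i) ^ 2
        set X := (degreeCount i G : ℝ) - n * degreeProb n p i
        rw [← sq_abs X, ← mul_le_mul_iff_right₀ hs, mul_add, mul_inv_cancel_left₀ hs.ne']
        nlinarith [sq_nonneg (√(n : ℝ) - |X|), abs_nonneg X]
    _ = √(n : ℝ) + (√(n : ℝ))⁻¹ * ∫ G, ((degreeCount i G : ℝ) - n * degreeProb n p i) ^ 2
        ∂(binomialRandom (Fin n) p) := by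
        rw [integral_add .of_finite .of_finite, integral_const_mul]
        simp
    _ ≤ √(n : ℝ) + (√(n : ℝ))⁻¹ * (n * (4 * Real.exp θ)) := by
        gcongr
        exact integral_degreeCount_sub_sq_le hp hpθ i
    _ = _ := by
        have : (√(n : ℝ))⁻¹ * (n * (4 * Real.exp θ)) = √(n : ℝ) * (4 * Real.exp θ) := by
          nth_rewrite 2 [← hs2]
          rw [mul_assoc, inv_mul_cancel_left₀ hs.ne']
        rw [this]
        ring

end Moments

/-! ### The limiting covariance and Poisson weights -/

section Poisson

/-- The Poisson weight `e^{-θ} θ^m / m!`. -/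
noncomputable def poissonWeight (θ : ℝ) (m : ℕ) : ℝ := θ ^ m / (m.factorial : ℝ) * Real.exp (-θ)

lemma poissonWeight_nonneg {θ : ℝ} (hθ : 0 ≤ θ) (m : ℕ) : 0 ≤ poissonWeight θ m := by
  unfold poissonWeight; positivity

lemma sum_poissonWeight_le_one {θ : ℝ} (hθ : 0 ≤ θ) (s : Finset ℕ) :
    ∑ m ∈ s, poissonWeight θ m ≤ 1 := by
  have h := (NormedSpace.expSeries_div_hasSum_exp θ).mul_right (Real.exp (-θ))
  rw [← Real.exp_eq_exp_ℝ, ← Real.exp_add, add_neg_cancel, Real.exp_zero] at h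
  exact sum_le_hasSum s (fun m _ => poissonWeight_nonneg hθ m) h

lemma poissonWeight_le_one {θ : ℝ} (hθ : 0 ≤ θ) (m : ℕ) : poissonWeight θ m ≤ 1 := by
  simpa using sum_poissonWeight_le_one hθ {m}

lemma poissonWeight_succ (θ : ℝ) (m : ℕ) :
    (m + 1) * poissonWeight θ (m + 1) = θ * poissonWeight θ m := by
  have : (m.factorial : ℝ) ≠ 0 := by positivity
  have : (m : ℝ) + 1 ≠ 0 := by positivity
  rw [poissonWeight, poissonWeight, Nat.factorial_succ, pow_succ]
  push_cast
  field_simp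

lemma limitCov_eq {θ : ℝ} (i j : ℕ) :
    limitCov θ i j = poissonWeight θ i * poissonWeight θ j *
      (((i : ℝ) - θ) * ((j : ℝ) - θ) / θ - 1) + if i = j then poissonWeight θ i else 0 := by
  have : Real.exp (-2 * θ) = Real.exp (-θ) * Real.exp (-θ) := by rw [← Real.exp_add]; ring_nf
  simp only [limitCov, poissonWeight, this, pow_add]
  congr 1
  ring

/-- The limiting covariance in the form in which it arises as a conditional covariance. -/
lemma limitCov_eq_sub {θ : ℝ} (hθ : θ ≠ 0) (i : ℕ) {j : ℕ} (hj : 1 ≤ j) :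
    limitCov θ i j = (if i = j then poissonWeight θ i else 0) -
      poissonWeight θ i * poissonWeight θ j +
      poissonWeight θ i * (i - θ) * (poissonWeight θ (j - 1) - poissonWeight θ j) := by
  obtain ⟨k, rfl⟩ : ∃ k, j = k + 1 := ⟨j - 1, by omega⟩
  have h := poissonWeight_succ θ k
  have h2 : poissonWeight θ k = (k + 1) * poissonWeight θ (k + 1) / θ := by
    rw [h]; field_simp
  rw [limitCov_eq, Nat.add_sub_cancel, h2]
  push_cast
  field_simp
  ring

/-- The quadratic form of the limiting covariance matrix is the variance of a function of a Poisson
variable plus a square. -/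
lemma posSemidef_limitCovMatrix {d : ℕ} {i : Fin d → ℕ} (hi : StrictMono i) {θ : ℝ} (hθ : 0 < θ) :
    (limitCovMatrix θ i).PosSemidef := by
  refine Matrix.PosSemidef.of_dotProduct_mulVec_nonneg ?_ fun x => ?_
  · ext a b
    simp only [limitCovMatrix, Matrix.conjTranspose_apply, Matrix.of_apply, star_trivial,
      limitCov_eq]
    by_cases h : i a = i b
    · rw [h]
    · rw [if_neg h, if_neg (Ne.symm h)]; ring
  · set q : Fin d → ℝ := fun a => poissonWeight θ (i a) with hq
    have hq0 : ∀ a, 0 ≤ q a := fun a => poissonWeight_nonneg hθ.le _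
    have hq1 : ∑ a, q a ≤ 1 := by
      have := sum_poissonWeight_le_one hθ.le (Finset.univ.map ⟨i, hi.injective⟩)
      simpa using this
    have key : star x ⬝ᵥ (limitCovMatrix θ i).mulVec x =
        (∑ a, q a * x a ^ 2 - (∑ a, q a * x a) ^ 2) + (∑ a, q a * (i a - θ) * x a) ^ 2 / θ := by
      have e1 : (∑ a, q a * x a) ^ 2 = ∑ a, ∑ b, (q a * x a) * (q b * x b) := by
        rw [sq, Finset.sum_mul_sum]
      have e2 : (∑ a, q a * (i a - θ) * x a) ^ 2 / θ =
          ∑ a, ∑ b, (q a * (i a - θ) * x a) * (q b * (i b - θ) * x b) / θ := by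
        rw [sq, Finset.sum_mul_sum]
        simp only [Finset.sum_div]
      have e3 : ∑ a, q a * x a ^ 2 = ∑ a, ∑ b, if i a = i b then q a * x a * x b else 0 := by
        refine Finset.sum_congr rfl fun a _ => ?_
        simp only [hi.injective.eq_iff, Finset.sum_ite_eq, Finset.mem_univ, if_true]
        ring
      rw [e1, e2, e3, ← Finset.sum_sub_distrib, ← Finset.sum_add_distrib]
      simp only [dotProduct, Matrix.mulVec, Finset.mul_sum, star_trivial]
      refine Finset.sum_congr rfl fun a _ => ?_
      rw [← Finset.sum_sub_distrib, ← Finset.sum_add_distrib]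
      refine Finset.sum_congr rfl fun b _ => ?_
      simp only [limitCovMatrix, Matrix.of_apply, limitCov_eq, hq]
      split_ifs with h <;> field_simp <;> ring
    have hcs : (∑ a, q a * x a) ^ 2 ≤ ∑ a, q a * x a ^ 2 := by
      have h1 := Finset.sum_mul_sq_le_sq_mul_sq Finset.univ (fun a => √(q a))
        (fun a => √(q a) * x a)
      have e1 : ∀ a, √(q a) * (√(q a) * x a) = q a * x a := fun a => by
        rw [← mul_assoc, Real.mul_self_sqrt (hq0 a)]
      have e2 : ∀ a, (√(q a) * x a) ^ 2 = q a * x a ^ 2 := fun a => by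
        rw [mul_pow, Real.sq_sqrt (hq0 a)]
      simp only [e1, e2, Real.sq_sqrt (hq0 _)] at h1
      exact h1.trans (mul_le_of_le_one_left
        (Finset.sum_nonneg fun a _ => mul_nonneg (hq0 a) (sq_nonneg _)) hq1)
    rw [key]
    have : 0 ≤ (∑ a, q a * (i a - θ) * x a) ^ 2 / θ := by positivity
    linarith

/-- The weights at zero of the binomial law with parameters `N`, `p` and of its Poisson limit, by
`e^{-p} (1 - p²) ≤ 1 - p ≤ e^{-p}` and Bernoulli's inequality. -/
lemma abs_one_sub_pow_sub_exp_le {p θ : ℝ} (hp0 : 0 ≤ p) (hp1 : p < 1) {N : ℕ} (hpθ : p * N = θ) :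
    |(1 - p) ^ N - Real.exp (-θ)| ≤ θ * p := by
  have hθ : 0 ≤ θ := by rw [← hpθ]; positivity
  have e : Real.exp (-θ) = Real.exp (-p) ^ N := by
    rw [← Real.exp_nat_mul, ← hpθ]; ring_nf
  have h1 : (1 - p) ^ N ≤ Real.exp (-θ) := by
    rw [e]
    exact pow_le_pow_left₀ (by linarith) (Real.one_sub_le_exp_neg p) N
  have h2 : Real.exp (-p) * (1 - p ^ 2) ≤ 1 - p := by
    rw [Real.exp_neg, inv_mul_le_iff₀ (Real.exp_pos p)]
    nlinarith [Real.add_one_le_exp p]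
  have h3 : Real.exp (-θ) * (1 - p ^ 2) ^ N ≤ (1 - p) ^ N := by
    rw [e, ← mul_pow]
    have : 0 ≤ 1 - p ^ 2 := by nlinarith
    exact pow_le_pow_left₀ (by positivity) h2 N
  have h4 : 1 - θ * p ≤ (1 - p ^ 2) ^ N := by
    have := one_add_mul_le_pow (a := -p ^ 2) (by nlinarith) N
    calc 1 - θ * p = 1 + N * -p ^ 2 := by rw [← hpθ]; ring
      _ ≤ _ := by simpa [sub_eq_add_neg] using this
  have h5 : Real.exp (-θ) ≤ 1 := Real.exp_le_one_iff.2 (by linarith)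
  have h6 := mul_le_mul_of_nonneg_left h4 (Real.exp_pos (-θ)).le
  rw [abs_le]
  constructor
  · nlinarith [mul_nonneg hθ hp0]
  · have := mul_nonneg hθ hp0
    linarith

/-- The recursion between consecutive binomial weights. -/
lemma degreeProb_succ (n : ℕ) (p : ℝ) (m : ℕ) :
    (m + 1) * (1 - p) * degreeProb n p (m + 1) =
      (((n - 1 : ℕ) : ℝ) - m) * p * degreeProb n p m := by
  unfold degreeProb
  generalize n - 1 = N
  rcases lt_or_ge m N with h | h
  · obtain ⟨k, rfl⟩ : ∃ k, N = m + 1 + k := ⟨N - (m + 1), by omega⟩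
    rw [Nat.add_sub_cancel_left, show m + 1 + k - m = k + 1 by omega]
    have hch : ((m + 1 + k).choose (m + 1) : ℝ) * (m + 1) = (m + 1 + k).choose m * (k + 1) := by
      have := Nat.choose_succ_right_eq (m + 1 + k) m
      rw [show m + 1 + k - m = k + 1 by omega] at this
      exact_mod_cast this
    push_cast
    linear_combination p ^ (m + 1) * (1 - p) ^ (k + 1) * hch
  · rw [Nat.choose_eq_zero_of_lt (by omega : N < m + 1)]
    rcases h.eq_or_lt with h | h
    · subst h; simp
    · rw [Nat.choose_eq_zero_of_lt h]; simp

/-- Poisson approximation of the degree distribution, with rate `1 / n`. -/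
lemma exists_abs_degreeProb_sub_poissonWeight_le {θ : ℝ} (hθ : 0 ≤ θ) (m : ℕ) :
    ∃ C, 0 ≤ C ∧ ∀ (n : ℕ) (p : unitInterval), 2 ≤ n → (p : ℝ) < 1 → (p : ℝ) * (n - 1) = θ →
      |degreeProb n p m - poissonWeight θ m| ≤ C * p := by
  induction m with
  | zero =>
    refine ⟨θ, hθ, fun n p hn hp hpθ => ?_⟩
    have := abs_one_sub_pow_sub_exp_le (N := n - 1) (θ := θ) p.2.1 hp
      (by rw [← hpθ]; push_cast [show 1 ≤ n by omega]; ring)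
    simpa [degreeProb, poissonWeight] using this
  | succ m ih =>
    obtain ⟨C, hC, h⟩ := ih
    refine ⟨θ * C + (2 * m + 1), by positivity, fun n p hn hp hpθ => ?_⟩
    have h1 := h n p hn hp hpθ
    have h2 := degreeProb_succ n p m
    have h3 := poissonWeight_succ θ m
    have hp0 : (0 : ℝ) ≤ p := p.2.1
    obtain ⟨a0, a1⟩ := degreeProb_mem_Icc hp (⟨0, by omega⟩ : Fin n) m
    obtain ⟨b0, b1⟩ := degreeProb_mem_Icc hp (⟨0, by omega⟩ : Fin n) (m + 1)
    have h4 : (((n - 1 : ℕ) : ℝ) - m) * p = θ - m * p := by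
      rw [← hpθ]; push_cast [show 1 ≤ n by omega]; ring
    rw [h4] at h2
    have e : ((m : ℝ) + 1) * (degreeProb n p (m + 1) - poissonWeight θ (m + 1)) =
        θ * (degreeProb n p m - poissonWeight θ m) +
          (p * ((m + 1) * degreeProb n p (m + 1)) - p * (m * degreeProb n p m)) := by
      linear_combination h2 - h3
    have hm : (0 : ℝ) ≤ m := by positivity
    have h5 : |((m : ℝ) + 1) * (degreeProb n p (m + 1) - poissonWeight θ (m + 1))| ≤
        (θ * C + (2 * m + 1)) * p := by
      rw [e]
      refine (abs_add_le _ _).trans ?_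
      rw [abs_mul, abs_of_nonneg hθ, ← mul_sub, abs_mul, abs_of_nonneg hp0]
      have h6 : |((m : ℝ) + 1) * degreeProb n p (m + 1) - m * degreeProb n p m| ≤ 2 * m + 1 := by
        rw [abs_le]
        constructor <;> nlinarith
      nlinarith [mul_le_mul_of_nonneg_left h1 hθ, mul_le_mul_of_nonneg_left h6 hp0]
    refine le_trans ?_ h5
    rw [abs_mul, abs_of_pos (by positivity : (0 : ℝ) < m + 1)]
    exact le_mul_of_one_le_left (abs_nonneg _) (by linarith)

end Poisson

/-! ### The approximate Stein identity for degree counts -/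

section SteinIdentity

open Classical SimpleGraph

variable {n : ℕ} {p : unitInterval} {θ : ℝ}

/-- The covariance of the centred indicator that `v` has degree `i` and of the change of the
number of vertices of degree `j` caused by attaching `v` to the graph `H` outside `v`. -/
noncomputable def attachCov (n : ℕ) (p : unitInterval) (θ : ℝ) (i j : ℕ) (v : Fin n)
    (H : SimpleGraph (Fin n)) : ℝ :=
  (if i = j then degreeProb n p i else 0) - degreeProb n p i * degreeProb n p j +
    degreeProb n p i * (i - θ) / (n - 1) * ∑ w ∈ Finset.univ.erase v,
      ((if (nbhd w H).card + 1 = j then (1 : ℝ) else 0) - if (nbhd w H).card = j then 1 else 0)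

lemma integral_centredIndicator_mul_degree (hp : (p : ℝ) < 1) (v : Fin n) (i j : ℕ) :
    ∫ G, centredIndicator n p i (nbhd v G) * (if (nbhd v G).card = j then (1 : ℝ) else 0)
      ∂(binomialRandom (Fin n) p) =
      (if i = j then degreeProb n p i else 0) - degreeProb n p i * degreeProb n p j := by
  have e : ∀ G : SimpleGraph (Fin n),
      centredIndicator n p i (nbhd v G) * (if (nbhd v G).card = j then (1 : ℝ) else 0) =
      (if i = j then 1 else 0) * (if (nbhd v G).card = i then (1 : ℝ) else 0) -
        degreeProb n p i * (if (nbhd v G).card = j then (1 : ℝ) else 0) := by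
    intro G
    unfold centredIndicator
    by_cases h1 : (nbhd v G).card = j
    · by_cases h2 : i = j
      · subst h2; simp [h1]
      · have : ¬ j = i := fun h => h2 h.symm
        simp [h1, h2, this]
    · by_cases h2 : i = j
      · subst h2; simp [h1]
      · simp [h1, h2]
  simp only [e]
  rw [integral_sub .of_finite .of_finite, integral_const_mul, integral_const_mul,
    integral_degree_eq hp, integral_degree_eq hp]
  simp

lemma integral_centredIndicator_mul_adj (hp : (p : ℝ) < 1) (hpθ : (p : ℝ) * (n - 1) = θ)
    {v w : Fin n} (hvw : w ≠ v) {i : ℕ} (hi : 1 ≤ i) :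
    ∫ G, centredIndicator n p i (nbhd v G) * (if w ∈ nbhd v G then (1 : ℝ) else 0)
      ∂(binomialRandom (Fin n) p) = degreeProb n p i * (i - θ) / (n - 1) := by
  have hn : (n : ℝ) - 1 ≠ 0 := by
    have : 2 ≤ n := by
      have h1 := v.2; have h2 := w.2; have h3 : w.1 ≠ v.1 := fun e => hvw (Fin.ext e)
      omega
    have : (2 : ℝ) ≤ n := by exact_mod_cast this
    linarith
  simp only [centredIndicator, sub_mul]
  rw [integral_sub .of_finite .of_finite, integral_const_mul, integral_degree_eq_mul_adj hp hvw hi,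
    integral_adj hp hvw, ← hpθ]
  field_simp

/-- Averaging over the neighbours of `v`, given the graph outside `v`. -/
lemma integral_centredIndicator_mul_degreeCount_sub (hp : (p : ℝ) < 1)
    (hpθ : (p : ℝ) * (n - 1) = θ) (v : Fin n) {i j : ℕ} (hi : 1 ≤ i) (hj : 1 ≤ j)
    (b : SimpleGraph (Fin n) → ℝ) :
    ∫ G, centredIndicator n p i (nbhd v G) *
        ((degreeCount j G : ℝ) - degreeCount j (G.deleteIncidenceSet v)) *
        b (G.deleteIncidenceSet v) ∂(binomialRandom (Fin n) p) =
      ∫ G, attachCov n p θ i j v (G.deleteIncidenceSet v) * b (G.deleteIncidenceSet v)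
        ∂(binomialRandom (Fin n) p) := by
  let c : Fin n → SimpleGraph (Fin n) → ℝ := fun w H =>
    (if (nbhd w H).card + 1 = j then (1 : ℝ) else 0) - if (nbhd w H).card = j then 1 else 0
  have e : ∀ G : SimpleGraph (Fin n), centredIndicator n p i (nbhd v G) *
        ((degreeCount j G : ℝ) - degreeCount j (G.deleteIncidenceSet v)) *
        b (G.deleteIncidenceSet v) =
      (centredIndicator n p i (nbhd v G) * (if (nbhd v G).card = j then (1 : ℝ) else 0)) *
        b (G.deleteIncidenceSet v) +
      ∑ w ∈ Finset.univ.erase v,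
        (centredIndicator n p i (nbhd v G) * (if w ∈ nbhd v G then (1 : ℝ) else 0)) *
        (c w (G.deleteIncidenceSet v) * b (G.deleteIncidenceSet v)) := by
    intro G
    rw [degreeCount_sub_degreeCount_deleteIncidenceSet, if_neg (by omega : ¬ 0 = j), sub_zero,
      mul_add, add_mul, Finset.mul_sum, Finset.sum_mul]
    congr 1
    exact Finset.sum_congr rfl fun w _ => by ring
  have e2 : ∀ G : SimpleGraph (Fin n), attachCov n p θ i j v (G.deleteIncidenceSet v) *
        b (G.deleteIncidenceSet v) =
      ((if i = j then degreeProb n p i else 0) - degreeProb n p i * degreeProb n p j) *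
        b (G.deleteIncidenceSet v) +
      ∑ w ∈ Finset.univ.erase v, degreeProb n p i * (i - θ) / (n - 1) *
        (c w (G.deleteIncidenceSet v) * b (G.deleteIncidenceSet v)) := by
    intro G
    rw [attachCov, add_mul, mul_assoc _ (∑ w ∈ _, _), Finset.sum_mul, Finset.mul_sum]
  simp only [e, e2]
  rw [integral_add .of_finite .of_finite, integral_add .of_finite .of_finite,
    integral_finsetSum _ fun _ _ => .of_finite, integral_finsetSum _ fun _ _ => .of_finite,
    integral_const_mul,
    integral_star_mul hp v (fun S => centredIndicator n p i S *
      (if S.card = j then (1 : ℝ) else 0)) b, integral_centredIndicator_mul_degree hp]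
  congr 1
  refine Finset.sum_congr rfl fun w hw => ?_
  rw [integral_star_mul hp v (fun S => centredIndicator n p i S *
      (if w ∈ S then (1 : ℝ) else 0)) (fun H => c w H * b H),
    integral_centredIndicator_mul_adj hp hpθ (Finset.ne_of_mem_erase hw) hi, integral_const_mul]

/-- Concentration of the degree counts outside `v`. -/
lemma integral_abs_degreeCount_deleteIncidenceSet_sub_le (hp : (p : ℝ) < 1)
    (hpθ : (p : ℝ) * (n - 1) = θ) (v : Fin n) (m : ℕ) {C : ℝ}
    (hC : |degreeProb n p m - poissonWeight θ m| ≤ C / √(n : ℝ)) :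
    ∫ G, |(degreeCount m (G.deleteIncidenceSet v) : ℝ) - (n - 1) * poissonWeight θ m|
      ∂(binomialRandom (Fin n) p) ≤ √(n : ℝ) * (2 + 8 * Real.exp θ + C) := by
  have hn : (1 : ℝ) ≤ n := by
    have : 1 ≤ n := by have := v.2; omega
    exact_mod_cast this
  have hs : 1 ≤ √(n : ℝ) := Real.one_le_sqrt.2 hn
  have hs2 : √(n : ℝ) * √(n : ℝ) = n := Real.mul_self_sqrt (by linarith)
  obtain ⟨h0, h1⟩ := degreeProb_mem_Icc hp v m
  have hC0 : 0 ≤ C := by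
    have := (abs_nonneg _).trans hC
    by_contra h
    exact absurd this (not_le.2 (div_neg_of_neg_of_pos (by linarith) (by linarith)))
  have h2 : |(n : ℝ) * degreeProb n p m - (n - 1) * poissonWeight θ m| ≤ 1 + √(n : ℝ) * C := by
    calc _ = |degreeProb n p m + (n - 1) * (degreeProb n p m - poissonWeight θ m)| := by
          congr 1; ring
      _ ≤ |degreeProb n p m| + |((n : ℝ) - 1) * (degreeProb n p m - poissonWeight θ m)| :=
          abs_add_le _ _
      _ ≤ 1 + (n : ℝ) * (C / √(n : ℝ)) := by
          rw [abs_mul, abs_of_nonneg h0, abs_of_nonneg (by linarith : (0 : ℝ) ≤ n - 1)]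
          gcongr
          linarith
      _ = 1 + √(n : ℝ) * C := by
          rw [← hs2, Real.sqrt_mul_self (by positivity)]
          field_simp
  calc _ ≤ ∫ G, ((1 + ((nbhd v G).card : ℝ)) + |(degreeCount m G : ℝ) - n * degreeProb n p m| +
        (1 + √(n : ℝ) * C)) ∂(binomialRandom (Fin n) p) :=
        integral_mono .of_finite .of_finite fun G => by
          have h3 := abs_degreeCount_sub_le m v G
          rw [abs_sub_comm] at h3
          calc _ = |((degreeCount m (G.deleteIncidenceSet v) : ℝ) - degreeCount m G) +
                ((degreeCount m G : ℝ) - n * degreeProb n p m) +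
                (n * degreeProb n p m - (n - 1) * poissonWeight θ m)| := by congr 1; ring
            _ ≤ _ := (abs_add_three _ _ _).trans (by gcongr)
    _ ≤ 4 * Real.exp θ + √(n : ℝ) * (1 + 4 * Real.exp θ) + (1 + √(n : ℝ) * C) := by
        rw [integral_add .of_finite .of_finite, integral_add .of_finite .of_finite]
        gcongr
        · exact integral_one_add_degree_le hp hpθ v
        · exact integral_abs_degreeCount_sub_le hp hpθ (by exact_mod_cast hn) m
        · simp
    _ ≤ √(n : ℝ) * (2 + 8 * Real.exp θ + C) := by
        nlinarith [mul_le_mul_of_nonneg_right hs (Real.exp_pos θ).le]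

/-- The conditional covariances concentrate around the limiting covariance. -/
lemma integral_abs_attachCov_sub_limitCov_le (hθ : 0 < θ) (hp : (p : ℝ) < 1)
    (hpθ : (p : ℝ) * (n - 1) = θ) (v : Fin n) {i j : ℕ} (hj : 1 ≤ j) {C : ℝ}
    (hCi : |degreeProb n p i - poissonWeight θ i| ≤ C / √(n : ℝ))
    (hCj : |degreeProb n p j - poissonWeight θ j| ≤ C / √(n : ℝ))
    (hCj' : |degreeProb n p (j - 1) - poissonWeight θ (j - 1)| ≤ C / √(n : ℝ)) :
    ∫ G, |attachCov n p θ i j v (G.deleteIncidenceSet v) - limitCov θ i j|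
      ∂(binomialRandom (Fin n) p) ≤
      (3 * C + 2 * (i + θ) * (5 + 16 * Real.exp θ + 3 * C)) / √(n : ℝ) := by
  have hn : (2 : ℝ) ≤ n := by
    have h1 : (1 : ℝ) ≤ n := by
      have : 1 ≤ n := by have := v.2; omega
      exact_mod_cast this
    rcases h1.lt_or_eq with h | h
    · have : 1 < n := by exact_mod_cast h
      exact_mod_cast (by omega : 2 ≤ n)
    · rw [← h] at hpθ
      simp at hpθ
      linarith
  have hs : 1 ≤ √(n : ℝ) := Real.one_le_sqrt.2 (by linarith)
  have hs2 : √(n : ℝ) * √(n : ℝ) = n := Real.mul_self_sqrt (by linarith)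
  have hC0 : 0 ≤ C := by
    have := (abs_nonneg _).trans hCi
    by_contra h
    exact absurd this (not_le.2 (div_neg_of_neg_of_pos (by linarith) (by linarith)))
  have hR := integral_abs_degreeCount_deleteIncidenceSet_sub_le hp hpθ v j hCj
  have hR' := integral_abs_degreeCount_deleteIncidenceSet_sub_le hp hpθ v (j - 1) hCj'
  obtain ⟨a0, a1⟩ := degreeProb_mem_Icc hp v i
  have qj0 := poissonWeight_nonneg hθ.le j
  have qj1 := poissonWeight_le_one hθ.le j
  have qk0 := poissonWeight_nonneg hθ.le (j - 1)
  have qk1 := poissonWeight_le_one hθ.le (j - 1)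
  set q := poissonWeight θ
  set π := degreeProb n (p : ℝ)
  set M : ℝ := (n : ℝ) - 1 with hM
  have hM0 : 0 < M := by linarith
  have hiθ : |(i : ℝ) - θ| ≤ i + θ := by
    have : (0 : ℝ) ≤ i := by positivity
    rw [abs_le]; constructor <;> linarith
  -- the deterministic part of the error
  have hdet : |((if i = j then π i else 0) - π i * π j) -
      ((if i = j then q i else 0) - q i * q j)| ≤
      3 * C / √(n : ℝ) := by
    have e1 : |(if i = j then π i else 0) - (if i = j then q i else 0)| ≤ C / √(n : ℝ) := by
      split_ifs
      · exact hCi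
      · simpa using (abs_nonneg _).trans hCi
    have e2 : |π i * (π j - q j)| ≤ C / √(n : ℝ) := by
      rw [abs_mul, abs_of_nonneg a0]
      exact (mul_le_of_le_one_left (abs_nonneg _) a1).trans hCj
    have e3 : |(π i - q i) * q j| ≤ C / √(n : ℝ) := by
      rw [abs_mul, abs_of_nonneg qj0]
      exact (mul_le_of_le_one_right (abs_nonneg _) qj1).trans hCi
    calc _ = |((if i = j then π i else 0) - (if i = j then q i else 0)) + -(π i * (π j - q j)) +
          -((π i - q i) * q j)| := by congr 1; ring
      _ ≤ C / √(n : ℝ) + C / √(n : ℝ) + C / √(n : ℝ) := by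
          refine (abs_add_three _ _ _).trans ?_
          rw [abs_neg, abs_neg]
          gcongr
      _ = _ := by ring
  -- the random part of the error
  have hpt : ∀ G : SimpleGraph (Fin n),
      |attachCov n p θ i j v (G.deleteIncidenceSet v) - limitCov θ i j| ≤ 3 * C / √(n : ℝ) +
        (i + θ) / M * (|(degreeCount (j - 1) (G.deleteIncidenceSet v) : ℝ) - M * q (j - 1)| +
          |(degreeCount j (G.deleteIncidenceSet v) : ℝ) - M * q j| + 1 + C / √(n : ℝ) * M) := by
    intro G
    rw [attachCov, limitCov_eq_sub hθ.ne' i hj, sum_erase_degree_indicators hj]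
    set A := (degreeCount (j - 1) (G.deleteIncidenceSet v) : ℝ)
    set B := (degreeCount j (G.deleteIncidenceSet v) : ℝ)
    set δ : ℝ := if j = 1 then 1 else 0
    have hδ : |δ| ≤ 1 := by simp only [δ]; split_ifs <;> simp
    have hbr : |π i * (A - M * q (j - 1)) - π i * (B - M * q j) - π i * δ +
        (π i - q i) * (M * (q (j - 1) - q j))| ≤
        |A - M * q (j - 1)| + |B - M * q j| + 1 + C / √(n : ℝ) * M := by
      refine (abs_add_le _ _).trans (add_le_add ((abs_sub _ _).trans (add_le_add
        ((abs_sub _ _).trans (add_le_add ?_ ?_)) ?_)) ?_)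
      · rw [abs_mul, abs_of_nonneg a0]
        exact mul_le_of_le_one_left (abs_nonneg _) a1
      · rw [abs_mul, abs_of_nonneg a0]
        exact mul_le_of_le_one_left (abs_nonneg _) a1
      · rw [abs_mul, abs_of_nonneg a0]
        exact mul_le_one₀ a1 (abs_nonneg _) hδ
      · rw [abs_mul, abs_mul, abs_of_pos hM0]
        have : |q (j - 1) - q j| ≤ 1 := by rw [abs_le]; constructor <;> linarith
        have : M * |q (j - 1) - q j| ≤ M := mul_le_of_le_one_right hM0.le this
        gcongr
    change |((if i = j then π i else 0) - π i * π j + π i * (i - θ) / M * (A - B - δ)) -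
      ((if i = j then q i else 0) - q i * q j + q i * (i - θ) * (q (j - 1) - q j))| ≤ _
    generalize (if i = j then π i else 0) = X at hdet ⊢
    generalize (if i = j then q i else 0) = Y at hdet ⊢
    calc _ = |(X - π i * π j - (Y - q i * q j)) +
          (i - θ) / M * (π i * (A - M * q (j - 1)) - π i * (B - M * q j) - π i * δ +
            (π i - q i) * (M * (q (j - 1) - q j)))| := by
          congr 1
          field_simp
          ring
      _ ≤ _ := by
          refine (abs_add_le _ _).trans (add_le_add hdet ?_)
          rw [abs_mul, abs_div, abs_of_pos hM0]
          gcongr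
  calc _ ≤ ∫ G, (3 * C / √(n : ℝ) + (i + θ) / M *
        (|(degreeCount (j - 1) (G.deleteIncidenceSet v) : ℝ) - M * q (j - 1)| +
          |(degreeCount j (G.deleteIncidenceSet v) : ℝ) - M * q j| + 1 + C / √(n : ℝ) * M))
        ∂(binomialRandom (Fin n) p) := integral_mono .of_finite .of_finite hpt
    _ = 3 * C / √(n : ℝ) + (i + θ) / M *
        (∫ G, |(degreeCount (j - 1) (G.deleteIncidenceSet v) : ℝ) - M * q (j - 1)|
            ∂(binomialRandom (Fin n) p) +
          ∫ G, |(degreeCount j (G.deleteIncidenceSet v) : ℝ) - M * q j|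
            ∂(binomialRandom (Fin n) p) + 1 + C / √(n : ℝ) * M) := by
        rw [integral_add .of_finite .of_finite, integral_const_mul,
          integral_add .of_finite .of_finite, integral_add .of_finite .of_finite,
          integral_add .of_finite .of_finite]
        simp
    _ ≤ 3 * C / √(n : ℝ) + (i + θ) / M * (√(n : ℝ) * (5 + 16 * Real.exp θ + 3 * C)) := by
        have h1 : C / √(n : ℝ) * M ≤ √(n : ℝ) * C := by
          rw [div_mul_eq_mul_div, div_le_iff₀ (by linarith)]
          nlinarith
        gcongr
        linarith
    _ ≤ _ := by
        have h2 : √(n : ℝ) / M ≤ 2 / √(n : ℝ) := by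
          rw [div_le_div_iff₀ hM0 (by linarith), hs2]
          linarith
        have h3 : 0 ≤ (i + θ) * (5 + 16 * Real.exp θ + 3 * C) := by
          have := Real.exp_pos θ
          positivity
        have h4 := mul_le_mul_of_nonneg_left h2 h3
        calc _ = 3 * C / √(n : ℝ) + (i + θ) * (5 + 16 * Real.exp θ + 3 * C) * (√(n : ℝ) / M) := by
              ring
          _ ≤ 3 * C / √(n : ℝ) + (i + θ) * (5 + 16 * Real.exp θ + 3 * C) * (2 / √(n : ℝ)) := by
              linarith
          _ = _ := by ring

end SteinIdentity

/-! ### The approximate Stein identity for the degree count vector -/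

section SteinVector

open Classical SimpleGraph

variable {n d : ℕ} {p : unitInterval} {θ : ℝ} {i : Fin d → ℕ}

/-- The random vector `(F_{i_1}, …, F_{i_d})` as a function of the graph. -/
noncomputable def degreeVector (n : ℕ) (p : unitInterval) (i : Fin d → ℕ)
    (G : SimpleGraph (Fin n)) : EuclideanSpace ℝ (Fin d) :=
  WithLp.toLp 2 fun a => normDegreeCount n p (i a) G

lemma degreeVector_apply (hp : (p : ℝ) < 1) (G : SimpleGraph (Fin n)) (a : Fin d) :
    degreeVector n p i G a = ((degreeCount (i a) G : ℝ) - n * degreeProb n p (i a)) / √(n : ℝ) := by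
  simp [degreeVector, normDegreeCount, integral_degreeCount hp]

lemma degreeVector_sub_apply (hp : (p : ℝ) < 1) (v : Fin n) (G : SimpleGraph (Fin n)) (a : Fin d) :
    degreeVector n p i G a - degreeVector n p i (G.deleteIncidenceSet v) a =
      ((degreeCount (i a) G : ℝ) - degreeCount (i a) (G.deleteIncidenceSet v)) / √(n : ℝ) := by
  rw [degreeVector_apply hp, degreeVector_apply hp]
  ring

lemma l1_degreeVector_sub_le (hp : (p : ℝ) < 1) (v : Fin n) (G : SimpleGraph (Fin n)) :
    l1 (degreeVector n p i G - degreeVector n p i (G.deleteIncidenceSet v)) ≤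
      d * (1 + ((nbhd v G).card : ℝ)) / √(n : ℝ) := by
  calc _ ≤ ∑ _a : Fin d, (1 + ((nbhd v G).card : ℝ)) / √(n : ℝ) := by
        refine Finset.sum_le_sum fun a _ => ?_
        rw [PiLp.sub_apply, degreeVector_sub_apply hp, abs_div, abs_of_nonneg (Real.sqrt_nonneg _)]
        gcongr
        exact abs_degreeCount_sub_le _ _ _
    _ = _ := by simp; ring

/-- The contribution of a single vertex to the Stein identity. Since the centred indicator is
independent of the graph outside `v`, only the increment of the test function matters. -/
lemma abs_integral_centredIndicator_mul_sub_le (hp : (p : ℝ) < 1)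
    (hpθ : (p : ℝ) * (n - 1) = θ) (hi1 : ∀ a, 1 ≤ i a) {C : ℝ} (a : Fin d) (v : Fin n)
    (hC : ∀ b, ∫ G, |attachCov n p θ (i a) (i b) v (G.deleteIncidenceSet v) -
      limitCov θ (i a) (i b)| ∂(binomialRandom (Fin n) p) ≤ C / √(n : ℝ))
    {h : EuclideanSpace ℝ (Fin d) → ℝ} {h' : Fin d → EuclideanSpace ℝ (Fin d) → ℝ}
    (hh : HasBoundedPartials h h') :
    |√(n : ℝ) * ∫ G, centredIndicator n p (i a) (nbhd v G) * h (degreeVector n p i G)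
        ∂(binomialRandom (Fin n) p) -
      ∑ b, limitCov θ (i a) (i b) * ∫ G, h' b (degreeVector n p i G)
        ∂(binomialRandom (Fin n) p)| ≤
      (d ^ 2 * (4 * Real.exp θ) + ∑ b, (C + |limitCov θ (i a) (i b)| * (d * (4 * Real.exp θ)))) /
        √(n : ℝ) := by
  set P := binomialRandom (Fin n) p
  set K := 4 * Real.exp θ
  set F := degreeVector n p i
  have hn : (0 : ℝ) < n := by
    have : 0 < n := by have := v.2; omega
    exact_mod_cast this
  have hs : 0 < √(n : ℝ) := Real.sqrt_pos.2 hn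
  have hs2 : √(n : ℝ) * √(n : ℝ) = n := Real.mul_self_sqrt hn.le
  -- second order Taylor remainder
  have hb : |√(n : ℝ) * ∫ G, centredIndicator n p (i a) (nbhd v G) * h (F G) ∂P -
      ∑ b, ∫ G, centredIndicator n p (i a) (nbhd v G) *
        ((degreeCount (i b) G : ℝ) - degreeCount (i b) (G.deleteIncidenceSet v)) *
        h' b (F (G.deleteIncidenceSet v)) ∂P| ≤ d ^ 2 * K / √(n : ℝ) := by
    have e : √(n : ℝ) * ∫ G, centredIndicator n p (i a) (nbhd v G) * h (F G) ∂P -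
        ∑ b, ∫ G, centredIndicator n p (i a) (nbhd v G) *
        ((degreeCount (i b) G : ℝ) - degreeCount (i b) (G.deleteIncidenceSet v)) *
        h' b (F (G.deleteIncidenceSet v)) ∂P =
        √(n : ℝ) * ∫ G, centredIndicator n p (i a) (nbhd v G) *
          (h (F G) - h (F (G.deleteIncidenceSet v)) -
            ∑ b, h' b (F (G.deleteIncidenceSet v)) * (F G b - F (G.deleteIncidenceSet v) b)) ∂P := by
      have hz := integral_centredIndicator_mul hp v (i a) fun H => h (F H)
      have pt : ∀ G : SimpleGraph (Fin n), centredIndicator n p (i a) (nbhd v G) *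
          (h (F G) - h (F (G.deleteIncidenceSet v)) -
            ∑ b, h' b (F (G.deleteIncidenceSet v)) * (F G b - F (G.deleteIncidenceSet v) b)) =
          centredIndicator n p (i a) (nbhd v G) * h (F G) -
          centredIndicator n p (i a) (nbhd v G) * h (F (G.deleteIncidenceSet v)) -
          (√(n : ℝ))⁻¹ * ∑ b, centredIndicator n p (i a) (nbhd v G) *
            ((degreeCount (i b) G : ℝ) - degreeCount (i b) (G.deleteIncidenceSet v)) *
            h' b (F (G.deleteIncidenceSet v)) := by
        intro G
        rw [mul_sub, mul_sub, Finset.mul_sum, Finset.mul_sum]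
        congr 1
        refine Finset.sum_congr rfl fun b _ => ?_
        rw [degreeVector_sub_apply hp]
        ring
      simp only [pt]
      rw [integral_sub .of_finite .of_finite, integral_sub .of_finite .of_finite, hz,
        integral_const_mul, integral_finsetSum _ fun _ _ => .of_finite, sub_zero, mul_sub,
        mul_inv_cancel_left₀ hs.ne']
    rw [e, abs_mul, abs_of_pos hs]
    have h1 : |∫ G, centredIndicator n p (i a) (nbhd v G) *
          (h (F G) - h (F (G.deleteIncidenceSet v)) -
            ∑ b, h' b (F (G.deleteIncidenceSet v)) * (F G b - F (G.deleteIncidenceSet v) b)) ∂P| ≤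
        d ^ 2 / n * K := by
      calc _ ≤ ∫ G, d ^ 2 / n * (1 + ((nbhd v G).card : ℝ)) ^ 2 ∂P := by
            refine (abs_integral_le_integral_abs).trans
              (integral_mono .of_finite .of_finite fun G => ?_)
            simp only [abs_mul]
            refine (mul_le_of_le_one_left (abs_nonneg _)
              (abs_centredIndicator_le hp v _ _)).trans ((hh.taylor _ _).trans ?_)
            refine (pow_le_pow_left₀ (l1_nonneg _) (l1_degreeVector_sub_le hp v G) 2).trans
              (le_of_eq ?_)
            rw [div_pow, mul_pow, Real.sq_sqrt hn.le]
            ring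
        _ ≤ _ := by
            rw [integral_const_mul]
            gcongr
            exact integral_one_add_degree_sq_le hp hpθ v
    refine (mul_le_mul_of_nonneg_left h1 hs.le).trans (le_of_eq ?_)
    rw [← hs2, Real.sqrt_mul_self hs.le]
    field_simp
  -- replacing the conditional covariances by their limits, and the reduced graph by the full graph
  have hc : ∀ b, |∫ G, centredIndicator n p (i a) (nbhd v G) *
        ((degreeCount (i b) G : ℝ) - degreeCount (i b) (G.deleteIncidenceSet v)) *
        h' b (F (G.deleteIncidenceSet v)) ∂P -
      limitCov θ (i a) (i b) * ∫ G, h' b (F G) ∂P| ≤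
      (C + |limitCov θ (i a) (i b)| * (d * K)) / √(n : ℝ) := by
    intro b
    rw [integral_centredIndicator_mul_degreeCount_sub hp hpθ v (hi1 a) (hi1 b)
      fun H => h' b (F H)]
    have h1 : |∫ G, (attachCov n p θ (i a) (i b) v (G.deleteIncidenceSet v) -
        limitCov θ (i a) (i b)) * h' b (F (G.deleteIncidenceSet v)) ∂P| ≤ C / √(n : ℝ) := by
      refine (abs_integral_le_integral_abs).trans
        ((integral_mono .of_finite .of_finite fun G => ?_).trans (hC b))
      simp only [abs_mul]
      exact mul_le_of_le_one_right (abs_nonneg _) (hh.bound _ _)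
    have h2 : |∫ G, (h' b (F G) - h' b (F (G.deleteIncidenceSet v))) ∂P| ≤ d * K / √(n : ℝ) := by
      calc _ ≤ ∫ G, d / √(n : ℝ) * (1 + ((nbhd v G).card : ℝ)) ∂P := by
            refine (abs_integral_le_integral_abs).trans
              (integral_mono .of_finite .of_finite fun G => ?_)
            refine (hh.lipschitz _ _ _).trans ((l1_degreeVector_sub_le hp v G).trans (le_of_eq ?_))
            ring
        _ ≤ d / √(n : ℝ) * K := by
            rw [integral_const_mul]
            gcongr
            exact integral_one_add_degree_le hp hpθ v
        _ = _ := by ring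
    have e : ∫ G, attachCov n p θ (i a) (i b) v (G.deleteIncidenceSet v) *
          h' b (F (G.deleteIncidenceSet v)) ∂P - limitCov θ (i a) (i b) * ∫ G, h' b (F G) ∂P =
        ∫ G, (attachCov n p θ (i a) (i b) v (G.deleteIncidenceSet v) -
          limitCov θ (i a) (i b)) * h' b (F (G.deleteIncidenceSet v)) ∂P -
        limitCov θ (i a) (i b) * ∫ G, (h' b (F G) - h' b (F (G.deleteIncidenceSet v))) ∂P := by
      simp only [sub_mul]
      rw [integral_sub .of_finite .of_finite, integral_sub .of_finite .of_finite,
        integral_const_mul]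
      ring
    rw [e]
    refine (abs_sub _ _).trans ?_
    rw [abs_mul, add_div, mul_div_assoc]
    gcongr
  calc _ ≤ d ^ 2 * K / √(n : ℝ) +
        ∑ b, (C + |limitCov θ (i a) (i b)| * (d * K)) / √(n : ℝ) := by
        refine (abs_sub_le _ _ _).trans (add_le_add hb ?_)
        rw [← Finset.sum_sub_distrib]
        exact (Finset.abs_sum_le_sum_abs _ _).trans (Finset.sum_le_sum fun b _ => hc b)
    _ = _ := by rw [add_div, Finset.sum_div]

/-- The vector of normalised degree counts satisfies the Gaussian integration by parts formula up
to an error of order `n^{-1/2}`. -/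
lemma abs_integral_degreeVector_mul_sub_le (hn : 1 ≤ n) (hp : (p : ℝ) < 1)
    (hpθ : (p : ℝ) * (n - 1) = θ) (hi1 : ∀ a, 1 ≤ i a) {C : ℝ} (a : Fin d)
    (hC : ∀ v b, ∫ G, |attachCov n p θ (i a) (i b) v (G.deleteIncidenceSet v) -
      limitCov θ (i a) (i b)| ∂(binomialRandom (Fin n) p) ≤ C / √(n : ℝ))
    {h : EuclideanSpace ℝ (Fin d) → ℝ} {h' : Fin d → EuclideanSpace ℝ (Fin d) → ℝ}
    (hh : HasBoundedPartials h h') :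
    |∫ G, degreeVector n p i G a * h (degreeVector n p i G) ∂(binomialRandom (Fin n) p) -
      ∑ b, limitCov θ (i a) (i b) * ∫ G, h' b (degreeVector n p i G)
        ∂(binomialRandom (Fin n) p)| ≤
      (d ^ 2 * (4 * Real.exp θ) + ∑ b, (C + |limitCov θ (i a) (i b)| * (d * (4 * Real.exp θ)))) /
        √(n : ℝ) := by
  have hn0 : (0 : ℝ) < n := by exact_mod_cast hn
  have hs : 0 < √(n : ℝ) := Real.sqrt_pos.2 hn0
  have hs2 : √(n : ℝ) * √(n : ℝ) = n := Real.mul_self_sqrt hn0.le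
  set X := ∑ b, limitCov θ (i a) (i b) * ∫ G, h' b (degreeVector n p i G)
        ∂(binomialRandom (Fin n) p)
  set T : Fin n → ℝ := fun v => ∫ G, centredIndicator n p (i a) (nbhd v G) *
    h (degreeVector n p i G) ∂(binomialRandom (Fin n) p)
  set R := (d ^ 2 * (4 * Real.exp θ) +
    ∑ b, (C + |limitCov θ (i a) (i b)| * (d * (4 * Real.exp θ)))) / √(n : ℝ)
  have hT : ∀ v, |√(n : ℝ) * T v - X| ≤ R := fun v =>
    abs_integral_centredIndicator_mul_sub_le hp hpθ hi1 a v (hC v) hh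
  have e1 : ∫ G, degreeVector n p i G a * h (degreeVector n p i G) ∂(binomialRandom (Fin n) p) =
      (√(n : ℝ))⁻¹ * ∑ v, T v := by
    rw [← integral_finsetSum _ fun _ _ => .of_finite, ← integral_const_mul]
    congr 1
    funext G
    rw [degreeVector_apply hp, degreeCount_sub_eq_sum_centredIndicator, ← Finset.sum_mul]
    ring
  have e2 : (√(n : ℝ))⁻¹ * ∑ v, T v - X = (n : ℝ)⁻¹ * ∑ v, (√(n : ℝ) * T v - X) := by
    rw [Finset.sum_sub_distrib, ← Finset.mul_sum]
    simp only [Finset.sum_const, Finset.card_univ, Fintype.card_fin, nsmul_eq_mul]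
    rw [← hs2, Real.sqrt_mul_self hs.le]
    field_simp
  rw [e1, e2, abs_mul, abs_of_pos (inv_pos.2 hn0), inv_mul_le_iff₀ hn0]
  calc _ ≤ ∑ v, |√(n : ℝ) * T v - X| := Finset.abs_sum_le_sum_abs _ _
    _ ≤ ∑ _v : Fin n, R := Finset.sum_le_sum fun v _ => hT v
    _ = _ := by simp

end SteinVector

end DegreeCLT

/-! ### The rate of convergence -/

theorem mainTheorem4 (d : ℕ) (hd : 1 ≤ d) (i : Fin d → ℕ) (hi : StrictMono i)
    (hi1 : ∀ a, 1 ≤ i a) (θ : ℝ) (hθ0 : 0 < θ) (hθ1 : θ < 1) :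
    (DegreeCLT.limitCovMatrix θ i).PosSemidef ∧
    ∃ c : ℝ, 0 < c ∧ ∀ᶠ n : ℕ in atTop,
      ∀ p : unitInterval, (p : ℝ) = θ / ((n : ℝ) - 1) →
        DegreeCLT.d4 (DegreeCLT.degreeVectorLaw n p i)
            (multivariateGaussian 0 (DegreeCLT.limitCovMatrix θ i)) ≤
          ENNReal.ofReal (c / √(n : ℝ)) := by
  open DegreeCLT SimpleGraph in
  have hS := posSemidef_limitCovMatrix hi hθ0
  refine ⟨hS, ?_⟩
  -- `C₀ m` is the constant of the Poisson approximation of the weight at `m`, and `C₁ / √n` bounds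
  -- the error at all weights `i_a`, `i_a - 1` that occur
  choose C₀ hC₀ hC₀' using exists_abs_degreeProb_sub_poissonWeight_le hθ0.le
  set C₁ : ℝ := 2 * θ * ∑ a, (C₀ (i a) + C₀ (i a - 1))
  have hC₁0 : 0 ≤ C₁ := mul_nonneg (by linarith)
    (Finset.sum_nonneg fun a _ => add_nonneg (hC₀ _) (hC₀ _))
  -- `C₂ / √n` bounds the errors of all conditional covariances, `C₃ / √n` those of the Stein
  -- identities in all coordinates
  set C₂ : ℝ := ∑ a, (3 * C₁ + 2 * (i a + θ) * (5 + 16 * Real.exp θ + 3 * C₁))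
  set C₃ : ℝ := ∑ a, (d ^ 2 * (4 * Real.exp θ) +
    ∑ b, (C₂ + |limitCov θ (i a) (i b)| * (d * (4 * Real.exp θ))))
  have hC₂t : ∀ a, 0 ≤ 3 * C₁ + 2 * (i a + θ) * (5 + 16 * Real.exp θ + 3 * C₁) := fun a => by
    positivity
  have hC₂0 : 0 ≤ C₂ := Finset.sum_nonneg fun a _ => hC₂t a
  have hC₃t : ∀ a, 0 ≤ d ^ 2 * (4 * Real.exp θ) +
    ∑ b, (C₂ + |limitCov θ (i a) (i b)| * (d * (4 * Real.exp θ))) := fun a => by positivity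
  have hC₃0 : 0 ≤ C₃ := Finset.sum_nonneg fun a _ => hC₃t a
  -- the summand `1` only makes the constant positive
  refine ⟨Real.pi / 2 * (d * C₃) + 1, by positivity, ?_⟩
  filter_upwards [eventually_ge_atTop 2] with n hn p hpn
  have hn2 : (2 : ℝ) ≤ n := by exact_mod_cast hn
  have hs : 1 ≤ √(n : ℝ) := Real.one_le_sqrt.2 (by linarith)
  have hs2 : √(n : ℝ) * √(n : ℝ) = n := Real.mul_self_sqrt (by linarith)
  have hpθ : (p : ℝ) * (n - 1) = θ := by
    rw [hpn, div_mul_cancel₀ _ (by linarith)]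
  have hp : (p : ℝ) < 1 := by
    rw [hpn, div_lt_one (by linarith)]
    linarith
  have hp2 : (p : ℝ) ≤ 2 * θ / √(n : ℝ) := by
    have : √(n : ℝ) ≤ 2 * (n - 1) := by nlinarith
    rw [hpn, div_le_div_iff₀ (by linarith) (by linarith)]
    nlinarith
  have hpois : ∀ m C, 0 ≤ C → C₀ m ≤ C → |degreeProb n p m - poissonWeight θ m| ≤
      2 * θ * C / √(n : ℝ) := fun m C hC hm => by
    refine (hC₀' m n p hn hp hpθ).trans ?_
    calc C₀ m * p ≤ C * (2 * θ / √(n : ℝ)) := mul_le_mul hm hp2 p.2.1 hC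
      _ = _ := by ring
  have hsum0 : 0 ≤ ∑ a, (C₀ (i a) + C₀ (i a - 1)) :=
    Finset.sum_nonneg fun a _ => add_nonneg (hC₀ _) (hC₀ _)
  have hle : ∀ a, C₀ (i a) + C₀ (i a - 1) ≤ ∑ a, (C₀ (i a) + C₀ (i a - 1)) := fun a =>
    Finset.single_le_sum (f := fun a => C₀ (i a) + C₀ (i a - 1))
      (fun a _ => add_nonneg (hC₀ _) (hC₀ _)) (Finset.mem_univ a)
  have hP : ∀ a, |degreeProb n p (i a) - poissonWeight θ (i a)| ≤ C₁ / √(n : ℝ) := fun a =>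
    hpois _ _ hsum0 ((le_add_of_nonneg_right (hC₀ _)).trans (hle a))
  have hP' : ∀ a, |degreeProb n p (i a - 1) - poissonWeight θ (i a - 1)| ≤ C₁ / √(n : ℝ) :=
    fun a => hpois _ _ hsum0 ((le_add_of_nonneg_left (hC₀ _)).trans (hle a))
  have hA : ∀ a v b, ∫ G, |attachCov n p θ (i a) (i b) v (G.deleteIncidenceSet v) -
      limitCov θ (i a) (i b)| ∂(binomialRandom (Fin n) p) ≤ C₂ / √(n : ℝ) := fun a v b => by
    refine (integral_abs_attachCov_sub_limitCov_le hθ0 hp hpθ v (hi1 b) (hP a) (hP b)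
      (hP' b)).trans ?_
    gcongr
    exact Finset.single_le_sum (f := fun a : Fin d => 3 * C₁ +
      2 * ((i a : ℝ) + θ) * (5 + 16 * Real.exp θ + 3 * C₁)) (fun a _ => hC₂t a) (Finset.mem_univ a)
  have hmeas : AEMeasurable (degreeVector n p i) (binomialRandom (Fin n) p) :=
    (measurable_of_finite _).aemeasurable
  have hlaw : degreeVectorLaw n p i = (binomialRandom (Fin n) p).map (degreeVector n p i) := rfl
  have : IsProbabilityMeasure (degreeVectorLaw n p i) := by
    rw [hlaw]; exact Measure.isProbabilityMeasure_map hmeas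
  refine iSup₂_le fun g hg => ENNReal.ofReal_le_ofReal ?_
  have hmain := abs_integral_sub_integral_multivariateGaussian_le (μ := degreeVectorLaw n p i)
    (ε := C₃ / √(n : ℝ)) ?_ hS (fun h h' hh a => ?_) hg
  · refine hmain.trans ?_
    rw [mul_div_assoc', mul_div_assoc']
    gcongr
    linarith
  · rw [hlaw, integrable_map_measure (by fun_prop) hmeas]
    exact .of_finite
  · have hc := hh.continuous
    have hc' := hh.continuous_partial
    rw [hlaw, integral_map hmeas (Continuous.aestronglyMeasurable (by fun_prop))]
    simp only [integral_map hmeas (hc' _).aestronglyMeasurable]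
    refine (abs_integral_degreeVector_mul_sub_le (by omega) hp hpθ hi1 a
      (fun v b => hA a v b) hh).trans ?_
    gcongr
    exact Finset.single_le_sum (f := fun a : Fin d => d ^ 2 * (4 * Real.exp θ) +
      ∑ b, (C₂ + |limitCov θ (i a) (i b)| * (d * (4 * Real.exp θ)))) (fun a _ => hC₃t a)
      (Finset.mem_univ a)
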